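/- Let $n\in\mathbb N$, let $\Omega\subset\mathbb R^n$ be a bounded open convex set (it then automatically has Lipschitz boundary), let $T>0$ and $\alpha>0$. Let $C^{1,\alpha}_0(\Omega,\mathbb R^n)$ be the closure of $C^\infty_c(\Omega,\mathbb R^n)$ in the norm $$\|u\|_{C^{1,\alpha}}=\sup_\Omega|u|+\sup_\Omega\|Du\|+\sup_{x\ne y\in\Omega}\frac{\|Du(x)-Du(y)\|}{|x-y|^\alpha},$$ its elements being extended by zero to $\mathbb R^n$. Let $\mathcal V$ be a Banach space that is continuously embedded into $C^{1,\alpha}_0(\Omega,\mathbb R^n)$, let $v\in L^2([0,T],\mathcal V)$ and $f_0\in L^2(\Omega,\mathbb R)$; write $v(t,x)$ for the value at $x$ of the vector field $v(t)$. A *weak solution* of the continuity equation $\partial_t f+\operatorname{div}_x(vf)=0$ with initial condition $f(0,\cdot)=f_0$ is a function $f\in C^0([0,T],L^2(\Omega,\mathbb R))$ such that, for all $\eta\in C^\infty_c([0,T)\times\Omega)$, $$\int_0^T\!\int_\Omega f(t,x)\bigl(v(t,x)\cdot\nabla_x\eta(t,x)+\partial_t\eta(t,x)\bigr)\,dx\,dt+\int_\Omega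 f_0(x)\,\eta(0,x)\,dx=0 .$$ A *flow* of the characteristic ODE is a map $(t,s,x)\mapsto X(t,s,x)\in\mathbb R^n$ on $[0,T]\times[0,T]\times\Omega$ such that for all $s\in[0,T]$ and $x\in\Omega$ the curve $t\mapsto X(t,s,x)$ is absolutely continuous on $[0,T]$, satisfies $\frac{d}{dt}X(t,s,x)=v(t,X(t,s,x))$ for almost every $t\in[0,T]$, and $X(s,s,x)=x$. Then there is exactly one flow $X$; for all $s,t\in[0,T]$ the map $X(t,s,\cdot)$ sends $\Omega$ to $\Omega$ and is continuously differentiable on $\Omega$. The continuity equation with initial datum $f_0$ has exactly one weak solution $f\in C^0([0,T],L^2(\Omega,\mathbb R))$, and for every $t\in[0,T]$, $$f(t,x)=\det\bigl(D_xX(0,t,x)\bigr)\,f_0\bigl(X(0,t,x)\bigr)\qquad\text{for almost every }x\in\Omega .$$ -/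

import Mathlib

open MeasureTheory Set
open scoped ENNReal NNReal ContDiff

namespace ContinuityEquation

/-- The Euclidean space `ℝⁿ`. -/
abbrev E (n : ℕ) : Type := EuclideanSpace ℝ (Fin n)

/-- The Hilbert space `L²(Ω, ℝ)`. -/
abbrev L2 {n : ℕ} (Ω : Set (E n)) : Type := Lp ℝ 2 ((volume : Measure (E n)).restrict Ω)

/-- `φ ∈ C^∞_c(U, F)`: smooth functions whose support is a compact subset of `U`. -/
def IsTestFunction {G F : Type*} [NormedAddCommGroup G] [NormedSpace ℝ G]
    [NormedAddCommGroup F] [NormedSpace ℝ F] (U : Set G) (φ : G → F) : Prop :=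
  ContDiff ℝ ∞ φ ∧ HasCompactSupport φ ∧ tsupport φ ⊆ U

/-- The `C^{1,α}(Ω, ℝⁿ)` norm (possibly infinite): supremum of `u` on `Ω`, plus supremum of `Du`
on `Ω`, plus `α`-Hölder seminorm of `Du` on `Ω`. For open `Ω` it depends on `u` restricted to `Ω`
only. -/
noncomputable def holderC1Norm {n : ℕ} (Ω : Set (E n)) (α : ℝ≥0) (u : E n → E n) : ℝ≥0∞ :=
  (⨆ x ∈ Ω, ‖u x‖ₑ) + (⨆ x ∈ Ω, ‖fderiv ℝ u x‖ₑ) + eHolderNorm α (Ω.domRestrict (fderiv ℝ u))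

/-- `u ∈ C^{1,α}_0(Ω, ℝⁿ)`, the closure of `C^∞_c(Ω, ℝⁿ)` in the `C^{1,α}(Ω, ℝⁿ)` norm.
A function on `Ω` is represented by its extension by zero to `ℝⁿ`. -/
structure MemC10 {n : ℕ} (Ω : Set (E n)) (α : ℝ≥0) (u : E n → E n) : Prop where
  eq_zero : ∀ x ∉ Ω, u x = 0
  contDiffOn : ContDiffOn ℝ 1 u Ω
  mem_closure : ∀ ε : ℝ≥0∞, 0 < ε →
    ∃ φ : E n → E n, IsTestFunction Ω φ ∧ holderC1Norm Ω α (u - φ) < ε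

/-- The linear map `ι` is a continuous embedding of the normed space `V` into
`C^{1,α}_0(Ω, ℝⁿ)`. -/
structure IsContinuousEmbedding {n : ℕ} (Ω : Set (E n)) (α : ℝ≥0) {V : Type*}
    [NormedAddCommGroup V] [NormedSpace ℝ V] (ι : V →ₗ[ℝ] (E n → E n)) : Prop where
  injective : Function.Injective ι
  mem : ∀ w : V, MemC10 Ω α (ι w)
  bound : ∃ C : ℝ≥0, ∀ w : V, holderC1Norm Ω α (ι w) ≤ C * ‖w‖ₑ

/-- `f ∈ C⁰([0,T], L²(Ω))` is a weak solution of `∂ₜ f + div (v f) = 0`, `f(0) = f₀`. The test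
functions `η ∈ C^∞_c([0,T) × Ω)`, smooth up to `t = 0`, are the restrictions to `[0,T) × Ω` of
the elements of `C^∞_c((-∞,T) × Ω)`. -/
def IsWeakSolution {n : ℕ} (T : ℝ) (Ω : Set (E n)) (v : ℝ → E n → E n) (f₀ : L2 Ω)
    (f : C(Icc (0 : ℝ) T, L2 Ω)) : Prop :=
  ∀ η : ℝ × E n → ℝ, IsTestFunction (Iio T ×ˢ Ω) η →
    (∫ t : Icc (0 : ℝ) T, (∫ x in Ω,
        f t x * (inner ℝ (v t x) (gradient (fun y => η (t, y)) x)
          + deriv (fun s => η (s, x)) t)) ∂(Measure.comap Subtype.val volume))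
      + ∫ x in Ω, f₀ x * η (0, x) = 0

/-- `X` is a flow of the characteristic ODE: for all initial times `s ∈ [0,T]` and initial points
`x ∈ Ω` the curve `t ↦ X t s x` is absolutely continuous on `[0,T]`, satisfies
`d/dt X t s x = v t (X t s x)` for almost every `t ∈ [0,T]`, and `X s s x = x`.
The arguments of `X` are time, initial time and initial point. -/
structure IsFlow {n : ℕ} (T : ℝ) (Ω : Set (E n)) (v : ℝ → E n → E n)
    (X : ℝ → ℝ → E n → E n) : Prop where
  absolutelyContinuous : ∀ s ∈ Icc 0 T, ∀ x ∈ Ω,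
    AbsolutelyContinuousOnInterval (fun t => X t s x) 0 T
  ode : ∀ s ∈ Icc 0 T, ∀ x ∈ Ω,
    ∀ᵐ t ∂(volume.restrict (Icc 0 T)), HasDerivAt (fun τ => X τ s x) (v t (X t s x)) t
  initial : ∀ s ∈ Icc 0 T, ∀ x ∈ Ω, X s s x = x

end ContinuityEquation

/-! Flow. Elements of `C^{1,α}_0`, extended by zero, are `C¹` on all of `ℝⁿ` with global Hölder
bounds on their derivatives, because they are uniform `C¹` limits of test functions. Cutting `v` off
outside `(0,T]` gives a field `b` on `ℝ × ℝⁿ` whose `C^{1,α}` bounds at time `t` are controlled by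
an integrable `m(t)`. A trajectory through `x` at time `s` is a solution `γ` of `γ - N γ = x` in the
Banach space of bounded continuous curves, where `N γ = ∫ₛ b(r, γ(r)) dr`. The Hölder bound makes
`N` a `C¹` map, and conjugation by the weight `exp(2|∫ₛᵗ m|)` makes it `1/2`-Lipschitz without any
smallness of `T`. Hence `1 - N` has a global `C¹` inverse (`exists_contDiff_inverse_of_lipschitz`),
which yields existence, uniqueness and `C¹` dependence on `x` together (`exists_solution`).
Uniqueness gives the group law. Points off `Ω` are stationary, so the flow preserves `Ω`.

Existence. The formula says that `f(t) dx` is the image of `f₀ dx` under `X(t,0,·)`. Tested against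
`η`, the equation becomes, for each starting point `y`, the integral of the derivative of `t ↦ η(t,
X(t,0,y))`, which equals `-η(0,y)`. Fubini then concludes. Continuity in `L²` follows by density of
bounded continuous data and a uniform operator bound.

Uniqueness. For a weak solution `f` and a test function `ψ`, the number `H(t) = ∫ f(t) ψ(X(0,t,·))`
has to be constant. The function `Φ_t = ψ(X(0,t,·))` is merely `C¹` in space and not smooth in time,
so it is not inserted into the weak equation directly. Instead the equation is tested with functions
of `x` alone, integrated in time and extended to `C¹` functions by mollification. Freezing `Φ_{t₂}`
on `[t₁,t₂]`, the change of `f` and the change of `Φ` cancel to first order, and `|H(t₂) - H(t₁)| ≤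
ε ∫ m` on short intervals (`setIntegral_mul_comp_flow`). Taking `ψ = φ(X(t,0,·))` turns constancy of
`H` into the formula for `f(t)`. -/

namespace ContinuityEquation

open Filter Topology BoundedContinuousFunction

/-! ### Absolutely continuous functions and the exponential weight. -/

section AbsolutelyContinuous

/-- A function whose increments are dominated by those of an absolutely continuous function is
absolutely continuous. -/
theorem absolutelyContinuousOnInterval_of_dist_le {X Y : Type*} [PseudoMetricSpace X]
    [PseudoMetricSpace Y] {f : ℝ → X} {g : ℝ → Y} {a b K : ℝ}
    (hg : AbsolutelyContinuousOnInterval g a b)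
    (h : ∀ x ∈ uIcc a b, ∀ y ∈ uIcc a b, dist (f x) (f y) ≤ K * dist (g x) (g y)) :
    AbsolutelyContinuousOnInterval f a b := by
  unfold AbsolutelyContinuousOnInterval at hg ⊢
  refine squeeze_zero' (Eventually.of_forall fun _ => Finset.sum_nonneg fun _ _ => dist_nonneg) ?_
    (by simpa using hg.const_mul K)
  rw [eventually_inf_principal]
  refine Eventually.of_forall fun ⟨k, I⟩ hI => ?_
  rw [Finset.mul_sum]
  exact Finset.sum_le_sum fun i hi => h _ (hI.1 i hi).1 _ (hI.1 i hi).2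

variable {F : Type*} [NormedAddCommGroup F] [NormedSpace ℝ F]

theorem norm_primitive_sub_le {g : ℝ → F} {m : ℝ → ℝ} (hm : Integrable m)
    (hg : Integrable g) (hgm : ∀ t, ‖g t‖ ≤ m t) (s x y : ℝ) :
    ‖(∫ r in s..x, g r) - ∫ r in s..y, g r‖ ≤ |∫ r in y..x, m r| := by
  rw [intervalIntegral.integral_interval_sub_left hg.intervalIntegrable hg.intervalIntegrable]
  exact intervalIntegral.norm_integral_le_abs_of_norm_le (Eventually.of_forall hgm)
    hm.intervalIntegrable

theorem absolutelyContinuousOnInterval_primitive {g : ℝ → F} (hg : Integrable g) (s a b : ℝ) :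
    AbsolutelyContinuousOnInterval (fun t => ∫ r in s..t, g r) a b := by
  have h1 := (hg.norm.intervalIntegrable (a := a) (b := b)
    ).absolutelyContinuousOnInterval_intervalIntegral (c := a) left_mem_uIcc
  refine absolutelyContinuousOnInterval_of_dist_le (K := 1) h1 fun x _ y _ => ?_
  rw [one_mul, dist_eq_norm, Real.dist_eq, intervalIntegral.integral_interval_sub_left
    hg.norm.intervalIntegrable hg.norm.intervalIntegrable]
  exact norm_primitive_sub_le hg.norm hg (fun _ => le_rfl) s x y

/-- Fundamental theorem of calculus for absolutely continuous vector-valued functions. -/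
theorem sub_eq_integral_of_absolutelyContinuous [CompleteSpace F] {f g : ℝ → F} {a b : ℝ}
    (hf : AbsolutelyContinuousOnInterval f a b) (hg : Integrable g)
    (h : ∀ᵐ t, t ∈ uIcc a b → HasDerivAt f (g t) t) {x y : ℝ} (hx : x ∈ uIcc a b)
    (hy : y ∈ uIcc a b) : f y - f x = ∫ r in x..y, g r := by
  -- Subtracting the primitive of `g` leaves an absolutely continuous function with derivative zero
  -- almost everywhere, that is, a constant.
  have hac := hf.sub (absolutelyContinuousOnInterval_primitive hg a a b)
  obtain ⟨c, hc⟩ := hac.const_of_ae_hasDerivAt_zero (by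
    filter_upwards [h, _root_.LocallyIntegrable.ae_hasDerivAt_integral hg.locallyIntegrable] with t h1 h2 ht
    have := (h1 ht).sub (h2 a)
    rwa [sub_self] at this)
  have h1 := (hc y hy).trans (hc x hx).symm
  simp only [Pi.sub_apply] at h1
  rw [← intervalIntegral.integral_interval_sub_left (a := a) hg.intervalIntegrable
    hg.intervalIntegrable]
  rw [sub_eq_sub_iff_add_eq_add] at h1 ⊢
  rw [h1, add_comm]

/-- The integrand is the almost everywhere derivative of `exp(2M)/2`. Since `M` is bounded and the
exponential is Lipschitz on bounded sets, this composition is absolutely continuous and the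
fundamental theorem applies. The factor `2` in the exponent is what later gives the contraction
constant `1/2`. -/
theorem integral_mul_exp_primitive {m : ℝ → ℝ} (hm : Integrable m) (s t : ℝ) :
    ∫ r in s..t, m r * Real.exp (2 * ∫ u in s..r, m u)
      = (Real.exp (2 * ∫ u in s..t, m u) - 1) / 2 := by
  set M : ℝ → ℝ := fun r => ∫ u in s..r, m u with hM
  have hMac := absolutelyContinuousOnInterval_primitive hm s s t
  have hMb : ∀ r, |M r| ≤ ∫ u, |m u| := fun r => by
    refine (intervalIntegral.norm_integral_le_integral_norm_uIoc (f := m) (μ := volume)).trans ?_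
    exact setIntegral_le_integral hm.norm (Eventually.of_forall fun _ => norm_nonneg _)
  set K := ∫ u, |m u|
  have hexp : AbsolutelyContinuousOnInterval (fun r => Real.exp (2 * M r) / 2) s t := by
    have hl : LipschitzOnWith (Real.exp (2 * K)).toNNReal (fun y => Real.exp (2 * y) / 2)
        (Icc (-K) K) := by
      refine Convex.lipschitzOnWith_of_nnnorm_hasDerivWithin_le (𝕜 := ℝ)
        (f' := fun y => Real.exp (2 * y)) (convex_Icc _ _) (fun y _ => ?_) fun y hy => ?_
      · exact (((((hasDerivAt_id' y).const_mul 2).exp.div_const 2)).congr_deriv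
          (by ring)).hasDerivWithinAt
      · rw [← NNReal.coe_le_coe, coe_nnnorm, Real.norm_eq_abs, Real.abs_exp,
          Real.coe_toNNReal _ (Real.exp_pos _).le]
        exact Real.exp_le_exp.2 (by linarith [hy.2])
    refine absolutelyContinuousOnInterval_of_dist_le
      (K := ((Real.exp (2 * K)).toNNReal : ℝ)) hMac fun x _ y _ => ?_
    exact hl.dist_le_mul _ (abs_le.1 (hMb x)) _ (abs_le.1 (hMb y))
  have hint : Integrable fun r => m r * Real.exp (2 * M r) := by
    refine hm.mul_bdd (c := Real.exp (2 * K)) ?_ (Eventually.of_forall fun r => ?_)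
    · have : Continuous M := intervalIntegral.continuous_primitive
        (fun _ _ => hm.intervalIntegrable) s
      exact (Real.continuous_exp.comp (continuous_const.mul this)).aestronglyMeasurable
    · rw [Real.norm_eq_abs, Real.abs_exp]
      exact Real.exp_le_exp.2 (by linarith [(abs_le.1 (hMb r)).2])
  rw [← sub_eq_integral_of_absolutelyContinuous hexp hint ?_ left_mem_uIcc right_mem_uIcc]
  · simp [hM, sub_div]
  · filter_upwards [_root_.LocallyIntegrable.ae_hasDerivAt_integral hm.locallyIntegrable] with r hr _
    exact (((hr s).const_mul 2).exp.div_const 2).congr_deriv (by simp only [hM]; ring)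

/-- The exponential weight that turns Volterra operators into contractions. -/
theorem abs_integral_mul_exp_abs_le {m : ℝ → ℝ} (hm : Integrable m) (hm0 : ∀ t, 0 ≤ m t)
    (s t : ℝ) :
    |∫ r in s..t, m r * Real.exp (2 * |∫ u in s..r, m u|)|
      ≤ Real.exp (2 * |∫ u in s..t, m u|) / 2 := by
  rcases le_total s t with h | h
  · have h1 : ∀ r ∈ uIcc s t, |∫ u in s..r, m u| = ∫ u in s..r, m u := fun r hr => by
      rw [uIcc_of_le h] at hr
      exact abs_of_nonneg (intervalIntegral.integral_nonneg hr.1 fun u _ => hm0 u)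
    rw [intervalIntegral.integral_congr (g := fun r => m r * Real.exp (2 * ∫ u in s..r, m u))
      fun r hr => by simp only [h1 r hr], integral_mul_exp_primitive hm, h1 t right_mem_uIcc,
      abs_of_nonneg]
    · linarith
    · have := Real.one_le_exp (x := 2 * ∫ u in s..t, m u)
        (by rw [← h1 t right_mem_uIcc]; positivity)
      linarith
  · have h1 : ∀ r ∈ uIcc s t, |∫ u in s..r, m u| = ∫ u in s..r, (-m) u := fun r hr => by
      rw [uIcc_of_ge h] at hr
      simp only [Pi.neg_apply, intervalIntegral.integral_neg]
      rw [intervalIntegral.integral_symm, abs_neg, neg_neg]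
      exact abs_of_nonneg (intervalIntegral.integral_nonneg hr.2 fun u _ => hm0 u)
    have h2 := integral_mul_exp_primitive hm.neg s t
    rw [intervalIntegral.integral_congr (g := fun r => -((-m) r * Real.exp (2 * ∫ u in s..r, (-m) u)))
      fun r hr => by simp only [h1 r hr]; simp, intervalIntegral.integral_neg, h2,
      h1 t right_mem_uIcc, abs_neg, abs_of_nonneg]
    · linarith
    · have := Real.one_le_exp (x := 2 * ∫ u in s..t, (-m) u)
        (by rw [← h1 t right_mem_uIcc]; positivity)
      linarith

end AbsolutelyContinuous

/-- A `C¹` perturbation of the identity by a `1/2`-Lipschitz map has a `C¹` inverse. -/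
theorem exists_contDiff_inverse_of_lipschitz {W : Type*} [NormedAddCommGroup W] [NormedSpace ℝ W]
    [CompleteSpace W] {P : W → W} (hP : ContDiff ℝ 1 P) (hL : LipschitzWith (1 / 2) P) :
    ∃ G : W → W, ContDiff ℝ 1 G ∧ (∀ y, G y - P (G y) = y) ∧ ∀ z, G (z - P z) = z := by
  rcases subsingleton_or_nontrivial W with hW | hW
  -- The trivial space is separate because `‖id‖ = 1` is used below.
  · exact ⟨id, contDiff_id, fun _ => Subsingleton.elim _ _, fun _ => Subsingleton.elim _ _⟩
  have hA : ApproximatesLinearOn (fun x => x - P x)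
      ((ContinuousLinearEquiv.refl ℝ W : W ≃L[ℝ] W) : W →L[ℝ] W) univ (1 / 2) := by
    intro x _ y _
    have h := hL.dist_le_mul x y
    rw [dist_eq_norm, dist_eq_norm] at h
    have : x - P x - (y - P y) - ((ContinuousLinearEquiv.refl ℝ W : W ≃L[ℝ] W) : W →L[ℝ] W) (x - y)
        = -(P x - P y) := by
      simp; abel
    rw [this, norm_neg]
    exact h
  have hc : Subsingleton W ∨ (1 / 2 : ℝ≥0) <
      ‖(((ContinuousLinearEquiv.refl ℝ W).symm : W ≃L[ℝ] W) : W →L[ℝ] W)‖₊⁻¹ := by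
    right
    have : ‖(((ContinuousLinearEquiv.refl ℝ W).symm : W ≃L[ℝ] W) : W →L[ℝ] W)‖₊ = 1 := by
      rw [← NNReal.coe_inj]
      exact ContinuousLinearMap.norm_id
    rw [this, inv_one]
    exact NNReal.half_lt_self one_ne_zero
  set f : W ≃ₜ W := hA.toHomeomorph _ hc with hf
  have hfx : ∀ x, f x = x - P x := fun x => rfl
  have hlt : ∀ x, ‖fderiv ℝ P x‖ < 1 := fun x =>
    (norm_fderiv_le_of_lipschitz ℝ hL).trans_lt (by norm_num)
  refine ⟨f.symm, ?_, fun y => ?_, fun z => ?_⟩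
  -- The derivative `1 - DP(x)` is invertible by the Neumann series, so the inverse homeomorphism is
  -- `C¹`.
  · refine f.contDiff_symm (f₀' := fun x => ContinuousLinearEquiv.unitsEquiv ℝ W
      (Units.oneSub (fderiv ℝ P x) (hlt x))) (fun x => ?_) (contDiff_id.sub hP)
    exact (hasFDerivAt_id x).sub (hP.differentiable one_ne_zero x).hasFDerivAt
  · rw [← hfx, f.apply_symm_apply]
  · rw [← hfx, f.symm_apply_apply]

end ContinuityEquation

/-! ### The Volterra operator on bounded continuous curves. -/

namespace ContinuityEquation

open Filter Topology BoundedContinuousFunction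

variable {F : Type*} [NormedAddCommGroup F] [NormedSpace ℝ F]

/-- A time-dependent vector field `b` of class `C^{1,α}` in space, with `C^{1,α}` bounds that are
integrable in time. -/
structure IsHolderField (α : ℝ≥0) (m : ℝ → ℝ) (b : ℝ → F → F) : Prop where
  integrable : Integrable m
  contDiff : ∀ t, ContDiff ℝ 1 (b t)
  norm_le : ∀ t x, ‖b t x‖ ≤ m t
  norm_fderiv_le : ∀ t x, ‖fderiv ℝ (b t) x‖ ≤ m t
  norm_fderiv_sub_le : ∀ t x y, ‖fderiv ℝ (b t) x - fderiv ℝ (b t) y‖ ≤ m t * ‖x - y‖ ^ (α : ℝ)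
  aestronglyMeasurable : ∀ γ : ℝ → F, Continuous γ →
    AEStronglyMeasurable (fun t => b t (γ t)) volume
  aestronglyMeasurable_fderiv : ∀ γ : ℝ → F, Continuous γ →
    AEStronglyMeasurable (fun t => fderiv ℝ (b t) (γ t)) volume

theorem continuous_primitive_of_integrable {g : ℝ → F} (hg : Integrable g) (s : ℝ) :
    Continuous fun t => ∫ r in s..t, g r :=
  intervalIntegral.continuous_primitive (fun _ _ => hg.intervalIntegrable) s

theorem norm_intervalIntegral_le_integral {g : ℝ → F} {m : ℝ → ℝ} (hm : Integrable m)
    (hgm : ∀ t, ‖g t‖ ≤ m t) (s t : ℝ) : ‖∫ r in s..t, g r‖ ≤ ∫ r, m r := by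
  have hm0 : ∀ t, 0 ≤ m t := fun t => (norm_nonneg _).trans (hgm t)
  refine (intervalIntegral.norm_integral_le_abs_of_norm_le (Eventually.of_forall hgm)
    hm.intervalIntegrable).trans ?_
  refine (intervalIntegral.norm_integral_le_integral_norm_uIoc (f := m) (μ := volume)).trans ?_
  simp_rw [Real.norm_of_nonneg (hm0 _)]
  exact setIntegral_le_integral hm (Eventually.of_forall hm0)

/-- The primitive of an integrable function, as a bounded continuous function. -/
noncomputable def primitive (g : ℝ → F) (hg : Integrable g) (s : ℝ) : ℝ →ᵇ F :=
  BoundedContinuousFunction.ofNormedAddCommGroup (fun t => ∫ r in s..t, g r)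
    (continuous_primitive_of_integrable hg s) (∫ r, ‖g r‖)
    (norm_intervalIntegral_le_integral hg.norm (fun _ => le_rfl) s)

@[simp] theorem primitive_apply (g : ℝ → F) (hg : Integrable g) (s t : ℝ) :
    primitive g hg s t = ∫ r in s..t, g r := rfl

/-- Pointwise multiplication by a bounded continuous scalar function. -/
noncomputable def smulBounded (w : ℝ →ᵇ ℝ) : (ℝ →ᵇ F) →L[ℝ] (ℝ →ᵇ F) :=
  LinearMap.mkContinuous
    { toFun := fun β => BoundedContinuousFunction.ofNormedAddCommGroup (fun t => w t • β t)
        (w.continuous.smul β.continuous) (‖w‖ * ‖β‖) fun t => by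
          rw [norm_smul]
          exact mul_le_mul (w.norm_coe_le_norm t) (β.norm_coe_le_norm t) (norm_nonneg _)
            (norm_nonneg _)
      map_add' := fun β β' => by ext t; simp
      map_smul' := fun c β => by ext t; exact smul_comm _ _ _ }
    ‖w‖ fun β => (BoundedContinuousFunction.norm_le (by positivity)).2 fun t => by
      refine (norm_smul (w t) (β t)).le.trans ?_
      exact mul_le_mul (w.norm_coe_le_norm t) (β.norm_coe_le_norm t) (norm_nonneg _) (norm_nonneg _)

@[simp] theorem smulBounded_apply (w : ℝ →ᵇ ℝ) (β : ℝ →ᵇ F) (t : ℝ) :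
    smulBounded w β t = w t • β t := rfl

namespace IsHolderField

variable {α : ℝ≥0} {m : ℝ → ℝ} {b : ℝ → F → F}

theorem nonneg (hb : IsHolderField α m b) (t : ℝ) : 0 ≤ m t :=
  (norm_nonneg _).trans (hb.norm_le t 0)

theorem hasFDerivAt (hb : IsHolderField α m b) (t : ℝ) (x : F) :
    HasFDerivAt (b t) (fderiv ℝ (b t) x) x :=
  ((hb.contDiff t).differentiable one_ne_zero x).hasFDerivAt

theorem norm_sub_le (hb : IsHolderField α m b) (t : ℝ) (x y : F) :
    ‖b t x - b t y‖ ≤ m t * ‖x - y‖ :=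
  convex_univ.norm_image_sub_le_of_norm_hasFDerivWithin_le
    (fun z _ => (hb.hasFDerivAt t z).hasFDerivWithinAt) (fun z _ => hb.norm_fderiv_le t z)
    (mem_univ y) (mem_univ x)

/-- Mean value inequality on the ball of radius `‖y - x‖` about `x`, where the derivative differs
from its value at `x` by at most `m t * ‖y - x‖ ^ α`. -/
theorem norm_remainder_le (hb : IsHolderField α m b) (t : ℝ) (x y : F) :
    ‖b t y - b t x - fderiv ℝ (b t) x (y - x)‖ ≤ m t * ‖y - x‖ ^ (α : ℝ) * ‖y - x‖ := by
  refine (convex_closedBall x ‖y - x‖).norm_image_sub_le_of_norm_hasFDerivWithin_le'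
    (fun z _ => (hb.hasFDerivAt t z).hasFDerivWithinAt) (fun z hz => ?_)
    (Metric.mem_closedBall_self (norm_nonneg _)) (by simp [dist_eq_norm])
  refine (hb.norm_fderiv_sub_le t z x).trans ?_
  have := hb.nonneg t
  rw [mem_closedBall_iff_norm] at hz
  gcongr

theorem integrable_comp (hb : IsHolderField α m b) {γ : ℝ → F} (hγ : Continuous γ) :
    Integrable fun t => b t (γ t) :=
  hb.integrable.mono' (hb.aestronglyMeasurable γ hγ) (Eventually.of_forall fun _ => hb.norm_le _ _)

theorem integrable_fderiv_comp (hb : IsHolderField α m b) {γ h : ℝ → F} (hγ : Continuous γ)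
    (hh : Continuous h) {K : ℝ} (hK : ∀ t, ‖h t‖ ≤ K) :
    Integrable fun t => fderiv ℝ (b t) (γ t) (h t) := by
  refine (hb.integrable.mul_const K).mono' ?_ (Eventually.of_forall fun t => ?_)
  · exact (ContinuousLinearMap.apply ℝ F).flip.aestronglyMeasurable_comp₂ 
      (hb.aestronglyMeasurable_fderiv γ hγ) hh.aestronglyMeasurable
  · refine (ContinuousLinearMap.le_opNorm _ _).trans ?_
    exact mul_le_mul (hb.norm_fderiv_le _ _) (hK t) (norm_nonneg _) (hb.nonneg t)

/-- The Volterra operator `γ ↦ ∫ₛᵗ b(r, γ(r)) dr`. -/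
noncomputable def volterra (hb : IsHolderField α m b) (s : ℝ) (γ : ℝ →ᵇ F) : ℝ →ᵇ F :=
  primitive _ (hb.integrable_comp γ.continuous) s

theorem volterra_apply (hb : IsHolderField α m b) (s : ℝ) (γ : ℝ →ᵇ F) (t : ℝ) :
    hb.volterra s γ t = ∫ r in s..t, b r (γ r) := rfl

/-- The derivative of the Volterra operator. -/
noncomputable def volterraDeriv (hb : IsHolderField α m b) (s : ℝ) (γ : ℝ →ᵇ F) :
    (ℝ →ᵇ F) →L[ℝ] (ℝ →ᵇ F) :=
  LinearMap.mkContinuous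
    { toFun := fun h => primitive _
        (hb.integrable_fderiv_comp γ.continuous h.continuous h.norm_coe_le_norm) s
      map_add' := fun h k => by
        ext t
        simp only [primitive_apply, BoundedContinuousFunction.coe_add, Pi.add_apply, map_add]
        exact intervalIntegral.integral_add
          (hb.integrable_fderiv_comp γ.continuous h.continuous h.norm_coe_le_norm).intervalIntegrable
          (hb.integrable_fderiv_comp γ.continuous k.continuous k.norm_coe_le_norm).intervalIntegrable
      map_smul' := fun c h => by
        ext t
        simp only [primitive_apply, BoundedContinuousFunction.coe_smul, map_smul]
        exact intervalIntegral.integral_smul c _ }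
    (∫ r, m r) fun h => by
      refine (BoundedContinuousFunction.norm_le (mul_nonneg (integral_nonneg hb.nonneg)
        (norm_nonneg _))).2 fun t => ?_
      rw [← integral_mul_const]
      refine norm_intervalIntegral_le_integral (hb.integrable.mul_const _) (fun r => ?_) s t
      refine (ContinuousLinearMap.le_opNorm _ _).trans ?_
      exact mul_le_mul (hb.norm_fderiv_le _ _) (h.norm_coe_le_norm r) (norm_nonneg _) (hb.nonneg r)

theorem volterraDeriv_apply (hb : IsHolderField α m b) (s : ℝ) (γ h : ℝ →ᵇ F) (t : ℝ) :
    hb.volterraDeriv s γ h t = ∫ r in s..t, fderiv ℝ (b r) (γ r) (h r) := rfl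

/-- The Hölder condition gives, after the factor `m(r)` is split off, one modulus of continuity for
all times. The pointwise Taylor remainder can therefore be integrated in time, and with `α > 0` the
result is `o(‖δ - γ‖)`. -/
theorem norm_volterra_remainder_le (hb : IsHolderField α m b) (s : ℝ) (γ δ : ℝ →ᵇ F) :
    ‖hb.volterra s δ - hb.volterra s γ - hb.volterraDeriv s γ (δ - γ)‖
      ≤ (∫ r, m r) * ‖δ - γ‖ ^ (α : ℝ) * ‖δ - γ‖ := by
  refine (BoundedContinuousFunction.norm_le (mul_nonneg (mul_nonneg (integral_nonneg hb.nonneg)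
    (by positivity)) (norm_nonneg _))).2 fun t => ?_
  have hi := (hb.integrable_fderiv_comp γ.continuous (δ - γ).continuous
    (δ - γ).norm_coe_le_norm).intervalIntegrable (a := s) (b := t)
  have h1 := (hb.integrable_comp γ.continuous).intervalIntegrable (a := s) (b := t)
  have h2 := (hb.integrable_comp δ.continuous).intervalIntegrable (a := s) (b := t)
  simp only [BoundedContinuousFunction.coe_sub, Pi.sub_apply, volterra_apply, volterraDeriv_apply]
    at hi ⊢
  rw [← intervalIntegral.integral_sub h2 h1, ← intervalIntegral.integral_sub (h2.sub h1) hi,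
    ← integral_mul_const, ← integral_mul_const]
  refine norm_intervalIntegral_le_integral ((hb.integrable.mul_const _).mul_const _)
    (fun r => ?_) s t
  refine (hb.norm_remainder_le r (γ r) (δ r)).trans ?_
  have h3 : ‖δ r - γ r‖ ≤ ‖δ - γ‖ := (δ - γ).norm_coe_le_norm r
  have := hb.nonneg r
  gcongr

theorem norm_volterraDeriv_sub_le (hb : IsHolderField α m b) (s : ℝ) (γ δ : ℝ →ᵇ F) :
    ‖hb.volterraDeriv s δ - hb.volterraDeriv s γ‖ ≤ (∫ r, m r) * ‖δ - γ‖ ^ (α : ℝ) := by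
  have h0 : 0 ≤ (∫ r, m r) * ‖δ - γ‖ ^ (α : ℝ) :=
    mul_nonneg (integral_nonneg hb.nonneg) (by positivity)
  refine ContinuousLinearMap.opNorm_le_bound _ h0 fun h => ?_
  refine (BoundedContinuousFunction.norm_le (mul_nonneg h0 (norm_nonneg _))).2 fun t => ?_
  have h1 := (hb.integrable_fderiv_comp γ.continuous h.continuous
    h.norm_coe_le_norm).intervalIntegrable (a := s) (b := t)
  have h2 := (hb.integrable_fderiv_comp δ.continuous h.continuous
    h.norm_coe_le_norm).intervalIntegrable (a := s) (b := t)
  simp only [_root_.sub_apply, BoundedContinuousFunction.coe_sub, Pi.sub_apply,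
    volterraDeriv_apply]
  rw [← intervalIntegral.integral_sub h2 h1, ← integral_mul_const, ← integral_mul_const]
  refine norm_intervalIntegral_le_integral ((hb.integrable.mul_const _).mul_const _)
    (fun r => ?_) s t
  rw [← _root_.sub_apply]
  refine (ContinuousLinearMap.le_opNorm _ _).trans ?_
  have h3 : ‖δ r - γ r‖ ≤ ‖δ - γ‖ := (δ - γ).norm_coe_le_norm r
  have := hb.nonneg r
  refine mul_le_mul ((hb.norm_fderiv_sub_le r _ _).trans ?_) (h.norm_coe_le_norm r)
    (norm_nonneg _) (by positivity)
  gcongr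

theorem hasFDerivAt_volterra (hb : IsHolderField α m b) (hα : 0 < α) (s : ℝ) (γ : ℝ →ᵇ F) :
    HasFDerivAt (hb.volterra s) (hb.volterraDeriv s γ) γ := by
  rw [hasFDerivAt_iff_tendsto]
  have hlim : Tendsto (fun δ : ℝ →ᵇ F => (∫ r, m r) * ‖δ - γ‖ ^ (α : ℝ)) (𝓝 γ) (𝓝 0) := by
    have h : Continuous fun δ : ℝ →ᵇ F => (∫ r, m r) * ‖δ - γ‖ ^ (α : ℝ) :=
      continuous_const.mul ((continuous_id.sub continuous_const).norm.rpow_const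
        fun _ => Or.inr α.coe_nonneg)
    simpa [(NNReal.coe_pos.2 hα).ne'] using h.tendsto γ
  refine squeeze_zero (fun δ => by positivity) (fun δ => ?_) hlim
  refine (mul_le_mul_of_nonneg_left (hb.norm_volterra_remainder_le s γ δ)
    (inv_nonneg.2 (norm_nonneg _))).trans ?_
  rcases eq_or_ne ‖δ - γ‖ 0 with h | h
  · rw [h]
    simp [(NNReal.coe_pos.2 hα).ne']
  · rw [mul_comm, mul_assoc, mul_inv_cancel₀ h, mul_one]

theorem contDiff_volterra (hb : IsHolderField α m b) (hα : 0 < α) (s : ℝ) :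
    ContDiff ℝ 1 (hb.volterra s) := by
  rw [contDiff_one_iff_fderiv]
  refine ⟨fun γ => (hb.hasFDerivAt_volterra hα s γ).differentiableAt, ?_⟩
  have : fderiv ℝ (hb.volterra s) = hb.volterraDeriv s :=
    funext fun γ => (hb.hasFDerivAt_volterra hα s γ).fderiv
  rw [this, continuous_iff_continuousAt]
  intro γ
  rw [ContinuousAt, tendsto_iff_norm_sub_tendsto_zero]
  have h : Continuous fun δ : ℝ →ᵇ F => (∫ r, m r) * ‖δ - γ‖ ^ (α : ℝ) :=
    continuous_const.mul ((continuous_id.sub continuous_const).norm.rpow_const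
      fun _ => Or.inr α.coe_nonneg)
  refine squeeze_zero (fun _ => norm_nonneg _) (fun δ => hb.norm_volterraDeriv_sub_le s γ δ) ?_
  simpa [(NNReal.coe_pos.2 hα).ne'] using h.tendsto γ

/-- The weight `exp (σ 2 |∫ₛᵗ m|)`. -/
noncomputable def weight (hb : IsHolderField α m b) (s σ : ℝ) : ℝ →ᵇ ℝ :=
  BoundedContinuousFunction.ofNormedAddCommGroup
    (fun t => Real.exp (σ * (2 * |∫ r in s..t, m r|)))
    (Real.continuous_exp.comp (continuous_const.mul (continuous_const.mul
      (continuous_primitive_of_integrable hb.integrable s).abs)))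
    (Real.exp (|σ| * (2 * ∫ r, m r))) fun t => by
      rw [Real.norm_eq_abs, Real.abs_exp, Real.exp_le_exp]
      have h1 : |∫ r in s..t, m r| ≤ ∫ r, m r :=
        norm_intervalIntegral_le_integral hb.integrable
          (fun r => (Real.norm_of_nonneg (hb.nonneg r)).le) s t
      have := le_abs_self σ
      gcongr

theorem weight_apply (hb : IsHolderField α m b) (s σ t : ℝ) :
    hb.weight s σ t = Real.exp (σ * (2 * |∫ r in s..t, m r|)) := rfl

theorem weight_mul_weight_neg (hb : IsHolderField α m b) (s t : ℝ) :
    hb.weight s 1 t * hb.weight s (-1) t = 1 := by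
  rw [weight_apply, weight_apply, ← Real.exp_add]
  simp

/-- The Volterra operator conjugated by the weight. -/
noncomputable def weightedVolterra (hb : IsHolderField α m b) (s : ℝ) (β : ℝ →ᵇ F) : ℝ →ᵇ F :=
  smulBounded (hb.weight s (-1)) (hb.volterra s (smulBounded (hb.weight s 1) β))

/-- A difference of curves bounded by the weight `exp(2|∫ₛᵗ m|)` is mapped to one bounded by `∫ m
exp(2|∫ m|)`, which is at most half the weight. This replaces a short-time argument. -/
theorem lipschitzWith_weightedVolterra (hb : IsHolderField α m b) (s : ℝ) :
    LipschitzWith (1 / 2) (hb.weightedVolterra s) := by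
  refine LipschitzWith.of_dist_le_mul fun β β' => ?_
  rw [dist_eq_norm, dist_eq_norm]
  refine (BoundedContinuousFunction.norm_le (by positivity)).2 fun t => ?_
  rw [BoundedContinuousFunction.coe_sub, Pi.sub_apply, weightedVolterra, weightedVolterra,
    smulBounded_apply, smulBounded_apply, volterra_apply, volterra_apply]
  rw [← smul_sub, norm_smul, ← intervalIntegral.integral_sub
    (hb.integrable_comp (smulBounded (hb.weight s 1) β).continuous).intervalIntegrable
    (hb.integrable_comp (smulBounded (hb.weight s 1) β').continuous).intervalIntegrable]
  have hwpos : ∀ σ t, 0 < hb.weight s σ t := fun σ t => Real.exp_pos _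
  have hint : Integrable fun r => m r * hb.weight s 1 r :=
    hb.integrable.mul_bdd (hb.weight s 1).continuous.aestronglyMeasurable
      (Eventually.of_forall (hb.weight s 1).norm_coe_le_norm)
  have h1 : ‖∫ r in s..t, (b r (smulBounded (hb.weight s 1) β r)
      - b r (smulBounded (hb.weight s 1) β' r))‖
      ≤ |∫ r in s..t, m r * hb.weight s 1 r * ‖β - β'‖| := by
    refine intervalIntegral.norm_integral_le_abs_of_norm_le (Eventually.of_forall fun r => ?_)
      (hint.mul_const _).intervalIntegrable
    refine (hb.norm_sub_le r _ _).trans ?_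
    rw [mul_assoc]
    refine mul_le_mul_of_nonneg_left ?_ (hb.nonneg r)
    rw [smulBounded_apply, smulBounded_apply, ← smul_sub, norm_smul,
      Real.norm_of_nonneg (hwpos 1 r).le]
    exact mul_le_mul_of_nonneg_left ((β - β').norm_coe_le_norm r) (hwpos 1 r).le
  rw [intervalIntegral.integral_mul_const, abs_mul, abs_norm] at h1
  have h2 : |∫ r in s..t, m r * hb.weight s 1 r| ≤ hb.weight s 1 t / 2 := by
    simp only [weight_apply, one_mul]
    exact abs_integral_mul_exp_abs_le hb.integrable hb.nonneg s t
  rw [Real.norm_of_nonneg (hwpos _ t).le]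
  calc _ ≤ hb.weight s (-1) t * (hb.weight s 1 t / 2 * ‖β - β'‖) := by
        refine mul_le_mul_of_nonneg_left (h1.trans ?_) (hwpos _ t).le
        gcongr
    _ = hb.weight s 1 t * hb.weight s (-1) t * (1 / 2 * ‖β - β'‖) := by ring
    _ = _ := by rw [hb.weight_mul_weight_neg]; simp

/-- Existence, uniqueness and `C¹` dependence on the initial value for `γ = x + ∫ₛ b(r, γ(r)) dr`,
in the space of bounded continuous curves. -/
theorem exists_solution [CompleteSpace F] (hb : IsHolderField α m b) (hα : 0 < α) (s : ℝ) :
    ∃ Γ : F → (ℝ →ᵇ F), ContDiff ℝ 1 Γ ∧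
      (∀ x t, Γ x t = x + ∫ r in s..t, b r (Γ x r)) ∧
      ∀ x (γ : ℝ →ᵇ F), (∀ t, γ t = x + ∫ r in s..t, b r (γ r)) → γ = Γ x := by
  have hC : ContDiff ℝ 1 (hb.weightedVolterra s) :=
    (smulBounded (F := F) (hb.weight s (-1))).contDiff.comp
      ((hb.contDiff_volterra hα s).comp (smulBounded (F := F) (hb.weight s 1)).contDiff)
  obtain ⟨G, hG, hG1, hG2⟩ := exists_contDiff_inverse_of_lipschitz hC
    (hb.lipschitzWith_weightedVolterra s)
  have hinv : ∀ β : ℝ →ᵇ F, smulBounded (hb.weight s 1) (smulBounded (hb.weight s (-1)) β) = β :=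
    fun β => by ext t; simp [smul_smul, hb.weight_mul_weight_neg]
  -- With weight `W`, the curve `β = W⁻¹ γ` turns `γ - N γ = x` into the equation for the conjugated
  -- operator with right-hand side `W⁻¹ x`, which `G` solves. Then `γ = W β`.
  refine ⟨fun x => smulBounded (hb.weight s 1)
    (G (smulBounded (hb.weight s (-1)) (BoundedContinuousFunction.const ℝ x))), ?_, ?_, ?_⟩
  · refine (smulBounded (F := F) (hb.weight s 1)).contDiff.comp (hG.comp
      ((smulBounded (F := F) (hb.weight s (-1))).contDiff.comp ?_))
    exact (LinearMap.mkContinuous (σ := RingHom.id ℝ)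
      { toFun := fun x => BoundedContinuousFunction.const ℝ x
        map_add' := fun x y => by ext; simp
        map_smul' := fun c x => by ext; simp } 1
      (fun x => by simp)).contDiff
  · intro x t
    have h := congrArg (smulBounded (hb.weight s 1))
      (hG1 (smulBounded (hb.weight s (-1)) (BoundedContinuousFunction.const ℝ x)))
    rw [map_sub, hinv, weightedVolterra, hinv, sub_eq_iff_eq_add] at h
    exact DFunLike.congr_fun h t
  · intro x γ hγ
    have h : γ - hb.volterra s γ = BoundedContinuousFunction.const ℝ x := by
      ext t
      simp [volterra_apply, sub_eq_iff_eq_add, ← hγ t]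
    have h2 := hG2 (smulBounded (hb.weight s (-1)) γ)
    rw [weightedVolterra, hinv, ← map_sub, h] at h2
    simp only [h2, hinv]

end IsHolderField

end ContinuityEquation

/-! ### Global regularity of fields in `C^{1,α}_0`. -/

namespace ContinuityEquation

open Filter Topology BoundedContinuousFunction

section VectorFields

variable {n : ℕ} {Ω : Set (E n)} {α : ℝ≥0}

theorem enorm_le_holderC1Norm (u : E n → E n) {x : E n} (hx : x ∈ Ω) :
    ‖u x‖ₑ ≤ holderC1Norm Ω α u :=
  (le_iSup₂ (f := fun x (_ : x ∈ Ω) => ‖u x‖ₑ) x hx).trans (le_self_add.trans le_self_add)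

theorem enorm_fderiv_le_holderC1Norm (u : E n → E n) {x : E n} (hx : x ∈ Ω) :
    ‖fderiv ℝ u x‖ₑ ≤ holderC1Norm Ω α u :=
  (le_iSup₂ (f := fun x (_ : x ∈ Ω) => ‖fderiv ℝ u x‖ₑ) x hx).trans
    (le_add_self.trans le_self_add)

theorem eHolderNorm_fderiv_le_holderC1Norm (u : E n → E n) :
    eHolderNorm α (Ω.domRestrict (fderiv ℝ u)) ≤ holderC1Norm Ω α u := le_add_self

-- Approximating test functions converge to `u` pointwise and their derivatives converge uniformly,
-- on `Ω` to `Du` and off `Ω` to zero because they vanish there. The theorem on limits of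
-- derivatives then works at boundary points too.
open Classical in
theorem MemC10.hasFDerivAt_and_continuous {u : E n → E n} (hΩ : IsOpen Ω) (hu : MemC10 Ω α u) :
    (∀ x, HasFDerivAt u (if x ∈ Ω then fderiv ℝ u x else 0) x) ∧
      Continuous fun x => if x ∈ Ω then fderiv ℝ u x else 0 := by
  have hpos : ∀ k : ℕ, (0 : ℝ≥0∞) < ((k : ℝ≥0∞) + 1)⁻¹ := fun k =>
    ENNReal.inv_pos.2 (by finiteness)
  choose φ hφ hφu using fun k : ℕ => hu.mem_closure _ (hpos k)
  have hdu : ∀ x ∈ Ω, DifferentiableAt ℝ u x := fun x hx =>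
    ((hu.contDiffOn.contDiffAt (hΩ.mem_nhds hx)).differentiableAt one_ne_zero)
  have hdφ : ∀ k, ContDiff ℝ 1 (φ k) := fun k => (hφ k).1.of_le (by norm_num)
  have hlim : Tendsto (fun k : ℕ => ((k : ℝ≥0∞) + 1)⁻¹) atTop (𝓝 0) := by
    have := (tendsto_add_atTop_iff_nat (f := fun k : ℕ => ((k : ℝ≥0∞))⁻¹) 1).2
      ENNReal.tendsto_inv_nat_nhds_zero
    simpa using this
  have hunif : TendstoUniformly (fun k x => fderiv ℝ (φ k) x)
      (fun x => if x ∈ Ω then fderiv ℝ u x else 0) atTop := by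
    rw [EMetric.tendstoUniformly_iff]
    intro ε hε
    filter_upwards [hlim.eventually_lt_const hε] with k hk x
    split_ifs with hx
    · refine lt_of_le_of_lt ?_ hk
      refine le_trans ?_ (hφu k).le
      rw [edist_eq_enorm_sub, ← fderiv_sub (hdu x hx) ((hdφ k).differentiable one_ne_zero x)]
      exact enorm_fderiv_le_holderC1Norm _ hx
    · rw [fderiv_of_notMem_tsupport ℝ fun h => hx ((hφ k).2.2 h), edist_self]
      exact hε
  have hpt : ∀ x, Tendsto (fun k => φ k x) atTop (𝓝 (u x)) := by
    intro x
    by_cases hx : x ∈ Ω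
    · rw [EMetric.tendsto_nhds]
      intro ε hε
      filter_upwards [hlim.eventually_lt_const hε] with k hk
      refine lt_of_le_of_lt ?_ hk
      refine le_trans ?_ (hφu k).le
      rw [edist_comm, edist_eq_enorm_sub]
      exact enorm_le_holderC1Norm (u - φ k) hx
    · rw [hu.eq_zero x hx]
      refine tendsto_const_nhds.congr fun k => ?_
      exact (image_eq_zero_of_notMem_tsupport fun h => hx ((hφ k).2.2 h)).symm
  refine ⟨hasFDerivAt_of_tendstoUniformly hunif
    (fun k x => ((hdφ k).differentiable one_ne_zero x).hasFDerivAt) hpt, ?_⟩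
  exact hunif.continuous (Frequently.of_forall fun k => (hdφ k).continuous_fderiv one_ne_zero)

theorem MemC10.fderiv_eq_zero {u : E n → E n} (hΩ : IsOpen Ω) (hu : MemC10 Ω α u) {x : E n}
    (hx : x ∉ Ω) : fderiv ℝ u x = 0 := by
  classical
  have := ((hu.hasFDerivAt_and_continuous hΩ).1 x).fderiv
  rwa [if_neg hx] at this

theorem MemC10.contDiff {u : E n → E n} (hΩ : IsOpen Ω) (hu : MemC10 Ω α u) :
    ContDiff ℝ 1 u := by
  classical
  obtain ⟨h1, h2⟩ := hu.hasFDerivAt_and_continuous hΩ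
  rw [contDiff_one_iff_fderiv]
  refine ⟨fun x => (h1 x).differentiableAt, h2.congr fun x => (h1 x).fderiv.symm⟩

theorem exists_mem_segment_frontier {S : Set (E n)} {x y : E n} (hx : x ∈ S) (hy : y ∉ S) :
    ∃ z ∈ segment ℝ x y, z ∈ frontier S := by
  by_contra! h
  have hor : ∀ z ∈ segment ℝ x y, z ∈ interior S ∨ z ∈ (closure S)ᶜ := fun z hz => by
    have := h z hz
    rw [frontier, Set.mem_sdiff] at this
    tauto
  obtain ⟨z, -, hz1, hz2⟩ := (convex_segment x y).isPreconnected _ _ isOpen_interior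
    isClosed_closure.isOpen_compl hor
    ⟨x, left_mem_segment ℝ x y, (hor x (left_mem_segment ℝ x y)).resolve_right
      fun h => h (subset_closure hx)⟩
    ⟨y, right_mem_segment ℝ x y, (hor y (right_mem_segment ℝ x y)).resolve_left
      fun h => hy (interior_subset h)⟩
  exact hz2 (subset_closure (interior_subset hz1))

/-- For `x` inside and `y` outside, the segment meets the frontier at some `z` with `g z = 0 = g y`
and `‖x - z‖ ≤ ‖x - y‖`. Continuity gives the estimate up to the closure, so the extension by zero
keeps the constant `K`. -/
theorem norm_sub_le_rpow_of_eq_zero_off {G : Type*} [NormedAddCommGroup G] {g : E n → G}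
    (hΩ : IsOpen Ω) (hg : Continuous g) (h0 : ∀ x ∉ Ω, g x = 0) {K : ℝ} (hK : 0 ≤ K)
    (h : ∀ x ∈ Ω, ∀ y ∈ Ω, ‖g x - g y‖ ≤ K * ‖x - y‖ ^ (α : ℝ)) (x y : E n) :
    ‖g x - g y‖ ≤ K * ‖x - y‖ ^ (α : ℝ) := by
  have hcl : ∀ x ∈ Ω, ∀ y ∈ closure Ω, ‖g x - g y‖ ≤ K * ‖x - y‖ ^ (α : ℝ) := by
    intro x hx y hy
    have hc : IsClosed {y | ‖g x - g y‖ ≤ K * ‖x - y‖ ^ (α : ℝ)} :=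
      isClosed_le (continuous_const.sub hg).norm (continuous_const.mul
        ((continuous_const.sub continuous_id).norm.rpow_const fun _ => Or.inr α.coe_nonneg))
    exact closure_minimal (fun y hy => h x hx y hy) hc hy
  have hmix : ∀ x ∈ Ω, ∀ y ∉ Ω, ‖g x - g y‖ ≤ K * ‖x - y‖ ^ (α : ℝ) := by
    intro x hx y hy
    obtain ⟨z, hz, hzf⟩ := exists_mem_segment_frontier hx hy
    have hzΩ : z ∉ Ω := by
      rw [hΩ.frontier_eq] at hzf
      exact hzf.2
    rw [h0 y hy, ← h0 z hzΩ]
    refine (hcl x hx z hzf.1).trans ?_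
    have : ‖x - z‖ ≤ ‖x - y‖ := by
      obtain ⟨a, c, ha, hc, hac, rfl⟩ := hz
      have : x - (a • x + c • y) = c • (x - y) := by
        rw [← one_smul ℝ x, ← hac]
        simp only [smul_add, smul_smul, smul_sub, add_smul]
        rw [← eq_sub_iff_add_eq] at hac
        subst hac
        module
      rw [this, norm_smul, Real.norm_of_nonneg hc]
      exact mul_le_of_le_one_left (norm_nonneg _) (by linarith)
    gcongr
  by_cases hx : x ∈ Ω <;> by_cases hy : y ∈ Ω
  · exact h x hx y hy
  · exact hmix x hx y hy
  · rw [norm_sub_rev, norm_sub_rev x y]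
    exact hmix y hy x hx
  · rw [h0 x hx, h0 y hy, sub_zero, norm_zero]
    positivity

variable {V : Type*} [NormedAddCommGroup V] [NormedSpace ℝ V]

/-- A linear family of globally `C^{1,α}` vector fields that vanish off `Ω`, with a uniform bound. -/
structure IsHolderFamily (Ω : Set (E n)) (α : ℝ≥0) (C : ℝ) (ι : V →ₗ[ℝ] (E n → E n)) : Prop where
  nonneg : 0 ≤ C
  eq_zero : ∀ w, ∀ x ∉ Ω, ι w x = 0
  contDiff : ∀ w, ContDiff ℝ 1 (ι w)
  norm_le : ∀ w x, ‖ι w x‖ ≤ C * ‖w‖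
  norm_fderiv_le : ∀ w x, ‖fderiv ℝ (ι w) x‖ ≤ C * ‖w‖
  norm_fderiv_sub_le : ∀ w x y,
    ‖fderiv ℝ (ι w) x - fderiv ℝ (ι w) y‖ ≤ C * ‖w‖ * ‖x - y‖ ^ (α : ℝ)

theorem norm_le_of_enorm_le {G V : Type*} [NormedAddCommGroup G] [NormedAddCommGroup V] {g : G} {C : ℝ≥0} {w : V}
    (h : ‖g‖ₑ ≤ C * ‖w‖ₑ) : ‖g‖ ≤ C * ‖w‖ := by
  rw [← enorm_norm w, ← ofReal_norm g] at h
  rw [← Real.toNNReal_coe (r := C)] at h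
  have h' : ENNReal.ofReal ‖g‖ ≤ ENNReal.ofReal (C * ‖w‖) := by
    rw [ENNReal.ofReal_mul C.coe_nonneg]
    refine h.trans (le_of_eq ?_)
    rw [Real.enorm_of_nonneg (norm_nonneg _)]
    rfl
  exact (ENNReal.ofReal_le_ofReal_iff (by positivity)).1 h'

theorem IsContinuousEmbedding.exists_isHolderFamily {ι : V →ₗ[ℝ] (E n → E n)} (hΩ : IsOpen Ω)
    (hι : IsContinuousEmbedding Ω α ι) : ∃ C : ℝ, IsHolderFamily Ω α C ι := by
  obtain ⟨C, hC⟩ := hι.bound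
  refine ⟨C, C.coe_nonneg, fun w => (hι.mem w).eq_zero, fun w => (hι.mem w).contDiff hΩ,
    fun w x => ?_, fun w x => ?_, fun w => ?_⟩
  · by_cases hx : x ∈ Ω
    · exact norm_le_of_enorm_le ((enorm_le_holderC1Norm _ hx).trans (hC w))
    · rw [(hι.mem w).eq_zero x hx, norm_zero]
      positivity
  · by_cases hx : x ∈ Ω
    · exact norm_le_of_enorm_le ((enorm_fderiv_le_holderC1Norm _ hx).trans (hC w))
    · rw [(hι.mem w).fderiv_eq_zero hΩ hx, norm_zero]
      positivity
  · refine norm_sub_le_rpow_of_eq_zero_off hΩ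
      (((hι.mem w).contDiff hΩ).continuous_fderiv one_ne_zero)
      (fun x hx => (hι.mem w).fderiv_eq_zero hΩ hx) (by positivity) fun x hx y hy => ?_
    have hle : eHolderNorm α (Ω.domRestrict (fderiv ℝ (ι w))) ≤ (C * ‖w‖₊ : ℝ≥0) :=
      ((eHolderNorm_fderiv_le_holderC1Norm _).trans (hC w)).trans_eq (by simp [enorm_eq_nnnorm])
    have hmem : MemHolder α (Ω.domRestrict (fderiv ℝ (ι w))) :=
      eHolderNorm_lt_top.1 (hle.trans_lt ENNReal.coe_lt_top)
    have h1 := hmem.holderWith.dist_le ⟨x, hx⟩ ⟨y, hy⟩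
    rw [← hmem.coe_nnHolderNorm_eq_eHolderNorm, ENNReal.coe_le_coe, ← NNReal.coe_le_coe] at hle
    rw [dist_eq_norm, Subtype.dist_eq, dist_eq_norm] at h1
    refine h1.trans ?_
    gcongr
    simpa using hle

namespace IsHolderFamily

variable {C : ℝ} {ι : V →ₗ[ℝ] (E n → E n)}

theorem fderiv_sub (hι : IsHolderFamily Ω α C ι) (w w' : V) (x : E n) :
    fderiv ℝ (ι (w - w')) x = fderiv ℝ (ι w) x - fderiv ℝ (ι w') x := by
  rw [map_sub]
  exact _root_.fderiv_sub ((hι.contDiff w).differentiable one_ne_zero x)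
    ((hι.contDiff w').differentiable one_ne_zero x)

/-- Linearity and the uniform bound make evaluation Lipschitz in `w`, uniformly in `x`. Joint
continuity then gives measurability of `t ↦ ι (v t) (γ t)` from strong measurability of `v`. -/
theorem continuous_uncurry (hι : IsHolderFamily Ω α C ι) :
    Continuous fun p : V × E n => ι p.1 p.2 := by
  refine continuous_prod_of_continuous_lipschitzWith _ C.toNNReal
    (fun w => (hι.contDiff w).continuous) fun x => LipschitzWith.of_dist_le_mul fun w w' => ?_
  rw [dist_eq_norm, dist_eq_norm, Real.coe_toNNReal _ hι.nonneg]
  have : ι w x - ι w' x = ι (w - w') x := by rw [map_sub]; rfl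
  rw [this]
  exact hι.norm_le _ _

theorem continuous_uncurry_fderiv (hι : IsHolderFamily Ω α C ι) :
    Continuous fun p : V × E n => fderiv ℝ (ι p.1) p.2 := by
  refine continuous_prod_of_continuous_lipschitzWith _ C.toNNReal
    (fun w => (hι.contDiff w).continuous_fderiv one_ne_zero)
    fun x => LipschitzWith.of_dist_le_mul fun w w' => ?_
  rw [dist_eq_norm, dist_eq_norm, Real.coe_toNNReal _ hι.nonneg]
  change ‖fderiv ℝ (ι w) x - fderiv ℝ (ι w') x‖ ≤ _
  rw [← hι.fderiv_sub]
  exact hι.norm_fderiv_le _ _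

theorem isHolderField (hι : IsHolderFamily Ω α C ι) {v : ℝ → V} (hv : Integrable v) :
    IsHolderField α (fun t => C * ‖v t‖) fun t => ι (v t) where
  integrable := hv.norm.const_mul C
  contDiff _ := hι.contDiff _
  norm_le _ := hι.norm_le _
  norm_fderiv_le _ := hι.norm_fderiv_le _
  norm_fderiv_sub_le _ := hι.norm_fderiv_sub_le _
  aestronglyMeasurable _ hγ := hι.continuous_uncurry.comp_aestronglyMeasurable
    (hv.aestronglyMeasurable.prodMk hγ.aestronglyMeasurable)
  aestronglyMeasurable_fderiv _ hγ := hι.continuous_uncurry_fderiv.comp_aestronglyMeasurable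
    (hv.aestronglyMeasurable.prodMk hγ.aestronglyMeasurable)

end IsHolderFamily

end VectorFields

end ContinuityEquation

/-! ### The flow: group law, invariance of `Ω`, regularity, uniqueness. -/

namespace ContinuityEquation

open Filter Topology BoundedContinuousFunction

namespace IsHolderField

variable {F : Type*} [NormedAddCommGroup F] [NormedSpace ℝ F] [CompleteSpace F]
  {α : ℝ≥0} {m : ℝ → ℝ} {b : ℝ → F → F}

/-- The integral curve of `b` that passes through `x` at time `s`. -/
noncomputable def curve (hb : IsHolderField α m b) (hα : 0 < α) (s : ℝ) : F → (ℝ →ᵇ F) :=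
  (hb.exists_solution hα s).choose

/-- The flow of `b`: time, initial time, initial point. -/
noncomputable def flow (hb : IsHolderField α m b) (hα : 0 < α) (t s : ℝ) (x : F) : F :=
  hb.curve hα s x t

variable (hb : IsHolderField α m b) (hα : 0 < α)

theorem contDiff_curve (s : ℝ) : ContDiff ℝ 1 (hb.curve hα s) :=
  (hb.exists_solution hα s).choose_spec.1

theorem flow_eq (t s : ℝ) (x : F) :
    hb.flow hα t s x = x + ∫ r in s..t, b r (hb.flow hα r s x) :=
  (hb.exists_solution hα s).choose_spec.2.1 x t

theorem continuous_flow_time (s : ℝ) (x : F) : Continuous fun t => hb.flow hα t s x :=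
  (hb.curve hα s x).continuous

/-- Integrability of `m` on `ℝ` forces every continuous solution to be bounded, so it lies in the
space where uniqueness is known. -/
theorem eq_flow {γ : ℝ → F} (hγ : Continuous γ) {s : ℝ} {x : F}
    (h : ∀ t, γ t = x + ∫ r in s..t, b r (γ r)) (t : ℝ) : γ t = hb.flow hα t s x := by
  have hbd : ∀ t, ‖γ t‖ ≤ ‖x‖ + ∫ r, m r := fun t => by
    rw [h t]
    exact (norm_add_le _ _).trans (add_le_add_right
      (norm_intervalIntegral_le_integral hb.integrable (fun r => hb.norm_le _ _) s t) _)
  exact DFunLike.congr_fun ((hb.exists_solution hα s).choose_spec.2.2 x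
    (BoundedContinuousFunction.ofNormedAddCommGroup γ hγ _ hbd) h) t

@[simp] theorem flow_self (s : ℝ) (x : F) : hb.flow hα s s x = x := by
  rw [flow_eq]
  simp

theorem integrable_flow (s : ℝ) (x : F) : Integrable fun t => b t (hb.flow hα t s x) :=
  hb.integrable_comp (hb.continuous_flow_time hα s x)

theorem flow_sub_flow (t t' s : ℝ) (x : F) :
    hb.flow hα t s x - hb.flow hα t' s x = ∫ r in t'..t, b r (hb.flow hα r s x) := by
  rw [hb.flow_eq hα t, hb.flow_eq hα t', add_sub_add_left_eq_sub,
    intervalIntegral.integral_interval_sub_left (hb.integrable_flow hα s x).intervalIntegrable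
    (hb.integrable_flow hα s x).intervalIntegrable]

theorem flow_flow (t s r : ℝ) (x : F) :
    hb.flow hα t s (hb.flow hα s r x) = hb.flow hα t r x := by
  refine (hb.eq_flow hα (hb.continuous_flow_time hα r x) (fun t => ?_) t).symm
  rw [← hb.flow_sub_flow hα t s r x]
  abel

theorem flow_flow_cancel (t s : ℝ) (x : F) : hb.flow hα s t (hb.flow hα t s x) = x := by
  rw [flow_flow, flow_self]

theorem flow_eq_self {x : F} (h : ∀ t, b t x = 0) (t s : ℝ) : hb.flow hα t s x = x := by
  refine (hb.eq_flow hα (γ := fun _ => x) continuous_const (fun t => ?_) t).symm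
  simp [h]

/-- Points off `Ω` are stationary. A trajectory that reached such a point, followed back in time,
would have started there. -/
theorem flow_mem {Ω : Set F} (h : ∀ t, ∀ x ∉ Ω, b t x = 0) (t s : ℝ) {x : F} (hx : x ∈ Ω) :
    hb.flow hα t s x ∈ Ω := by
  by_contra hn
  have h1 := hb.flow_eq_self hα (fun r => h r _ hn) s t
  rw [flow_flow_cancel] at h1
  exact hn (h1 ▸ hx)

theorem norm_flow_sub_flow_le (t t' s : ℝ) (x : F) :
    ‖hb.flow hα t s x - hb.flow hα t' s x‖ ≤ |∫ r in t'..t, m r| := by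
  rw [flow_sub_flow]
  exact intervalIntegral.norm_integral_le_abs_of_norm_le
    (Eventually.of_forall fun r => hb.norm_le _ _) hb.integrable.intervalIntegrable

theorem norm_flow_sub_self_le (t s : ℝ) (x : F) :
    ‖hb.flow hα t s x - x‖ ≤ |∫ r in s..t, m r| := by
  simpa using hb.norm_flow_sub_flow_le hα t s s x

theorem contDiff_flow (t s : ℝ) : ContDiff ℝ 1 (hb.flow hα t s) :=
  (BoundedContinuousFunction.evalCLM ℝ (β := F) t).contDiff.comp (hb.contDiff_curve hα s)

theorem continuous_flow (s : ℝ) : Continuous fun p : ℝ × F => hb.flow hα p.1 s p.2 :=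
  ((hb.contDiff_curve hα s).continuous.comp continuous_snd).eval continuous_fst

/-- By the group law `X(s,t',x) = X(s,t,X(t,t',x))`, and the inner point differs from `x` by at most
`|∫ m|` between `t'` and `t`. Continuity in the initial time is thus reduced to continuity of
`X(s,t,·)`. -/
theorem continuous_flow_initial (s : ℝ) : Continuous fun p : ℝ × F => hb.flow hα s p.1 p.2 := by
  rw [continuous_iff_continuousAt]
  rintro ⟨t, x⟩
  have h1 : ∀ p : ℝ × F, hb.flow hα s p.1 p.2 = hb.flow hα s t (hb.flow hα t p.1 p.2) := fun p => by
    rw [flow_flow]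
  have h2 : Tendsto (fun p : ℝ × F => hb.flow hα t p.1 p.2) (𝓝 (t, x)) (𝓝 x) := by
    have h3 : Tendsto (fun p : ℝ × F => |∫ r in p.1..t, m r|) (𝓝 (t, x)) (𝓝 0) := by
      have hc : Continuous fun p : ℝ × F => |∫ r in p.1..t, m r| := by
        simp_rw [fun u : ℝ => intervalIntegral.integral_symm (f := m) (μ := volume) t u]
        exact ((continuous_primitive_of_integrable hb.integrable t).comp continuous_fst).neg.abs
      simpa using hc.tendsto (t, x)
    have h4 : Tendsto (fun p : ℝ × F => hb.flow hα t p.1 p.2 - p.2) (𝓝 (t, x)) (𝓝 0) :=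
      squeeze_zero_norm (fun p => hb.norm_flow_sub_self_le hα t p.1 p.2) h3
    simpa using h4.add (continuous_snd.tendsto (t, x))
  rw [ContinuousAt, funext h1]
  exact (((hb.contDiff_flow hα s t).continuous.tendsto x).comp h2)

theorem hasFDerivAt_flow (t s : ℝ) (x : F) :
    HasFDerivAt (hb.flow hα t s) (fderiv ℝ (hb.flow hα t s) x) x :=
  ((hb.contDiff_flow hα t s).differentiable one_ne_zero x).hasFDerivAt

theorem fderiv_flow_comp (t s : ℝ) (x : F) :
    (fderiv ℝ (hb.flow hα s t) (hb.flow hα t s x)).comp (fderiv ℝ (hb.flow hα t s) x)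
      = ContinuousLinearMap.id ℝ F := by
  have h := (hb.hasFDerivAt_flow hα s t (hb.flow hα t s x)).comp x (hb.hasFDerivAt_flow hα t s x)
  have hid : hb.flow hα s t ∘ hb.flow hα t s = id := funext fun y => hb.flow_flow_cancel hα t s y
  rw [hid] at h
  exact h.unique (hasFDerivAt_id x)

theorem fderiv_flow_comp' (t s : ℝ) (x : F) :
    (fderiv ℝ (hb.flow hα t s) x).comp (fderiv ℝ (hb.flow hα s t) (hb.flow hα t s x))
      = ContinuousLinearMap.id ℝ F := by
  have h := hb.fderiv_flow_comp hα s t (hb.flow hα t s x)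
  rwa [flow_flow_cancel] at h

/-- The space derivative of the flow as a unit of the algebra of endomorphisms. -/
noncomputable def fderivUnit (t s : ℝ) (x : F) : (F →L[ℝ] F)ˣ where
  val := fderiv ℝ (hb.flow hα t s) x
  inv := fderiv ℝ (hb.flow hα s t) (hb.flow hα t s x)
  val_inv := hb.fderiv_flow_comp' hα t s x
  inv_val := hb.fderiv_flow_comp hα t s x

theorem inverse_fderiv_flow (t s : ℝ) (x : F) :
    Ring.inverse (fderiv ℝ (hb.flow hα t s) (hb.flow hα s t x))
      = fderiv ℝ (hb.flow hα s t) x := by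
  have h := Ring.inverse_unit (hb.fderivUnit hα t s (hb.flow hα s t x))
  refine h.trans ?_
  change fderiv ℝ (hb.flow hα s t) (hb.flow hα t s (hb.flow hα s t x)) = _
  rw [flow_flow_cancel]

/-- Evaluation at a time is linear and continuous on curves, so `D_x X(t,s,x) h` is the value at `t`
of the curve `D(curve)(x) h`. Finite dimension lets joint continuity be checked for each fixed `h`.
-/
theorem continuous_fderiv_flow [FiniteDimensional ℝ F] (s : ℝ) :
    Continuous fun p : ℝ × F => fderiv ℝ (hb.flow hα p.1 s) p.2 := by
  rw [continuous_clm_apply]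
  intro h
  have h1 : ∀ p : ℝ × F, fderiv ℝ (hb.flow hα p.1 s) p.2 h
      = fderiv ℝ (hb.curve hα s) p.2 h p.1 := fun p => by
    have := (BoundedContinuousFunction.evalCLM ℝ (β := F) p.1).hasFDerivAt.comp p.2
      ((hb.contDiff_curve hα s).differentiable one_ne_zero p.2).hasFDerivAt
    change fderiv ℝ (BoundedContinuousFunction.evalCLM ℝ (β := F) p.1 ∘ hb.curve hα s) p.2 h = _
    rw [this.fderiv]
    rfl
  simp_rw [h1]
  refine Continuous.eval ?_ continuous_fst
  exact (((hb.contDiff_curve hα s).continuous_fderiv one_ne_zero).comp continuous_snd).clm_apply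
    continuous_const

/-- `D_x X(s,t,x)` is the inverse of `D_x X(t,s,·)` at `X(s,t,x)`, and inversion is continuous at
units. -/
theorem continuous_fderiv_flow_initial [FiniteDimensional ℝ F] (s : ℝ) :
    Continuous fun p : ℝ × F => fderiv ℝ (hb.flow hα s p.1) p.2 := by
  simp_rw [← fun p : ℝ × F => hb.inverse_fderiv_flow hα p.1 s p.2]
  rw [continuous_iff_continuousAt]
  intro p
  have h1 : Continuous fun p : ℝ × F =>
      fderiv ℝ (hb.flow hα p.1 s) (hb.flow hα s p.1 p.2) :=
    (hb.continuous_fderiv_flow hα s).comp (continuous_fst.prodMk (hb.continuous_flow_initial hα s))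
  exact ContinuousAt.comp (f := fun p : ℝ × F =>
      fderiv ℝ (hb.flow hα p.1 s) (hb.flow hα s p.1 p.2)) (x := p)
    (NormedRing.inverse_continuousAt (hb.fderivUnit hα p.1 s (hb.flow hα s p.1 p.2)))
    h1.continuousAt

/-- The determinant never vanishes, depends continuously on `t` and equals `1` at `t = s`.
Positivity removes the absolute value from the change of variables, as the formula in the theorem
requires. -/
theorem det_fderiv_flow_pos [FiniteDimensional ℝ F] (t s : ℝ) (x : F) :
    0 < (fderiv ℝ (hb.flow hα s t) x).det := by
  have hne : ∀ t, (fderiv ℝ (hb.flow hα s t) x).det ≠ 0 := fun t h => by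
    have h1 := congrArg ContinuousLinearMap.det (hb.fderiv_flow_comp hα s t x)
    have h2 : ((fderiv ℝ (hb.flow hα t s) (hb.flow hα s t x)).comp
      (fderiv ℝ (hb.flow hα s t) x)).det = _ := LinearMap.det_comp _ _
    rw [h2] at h1
    change _ * (fderiv ℝ (hb.flow hα s t) x).det = _ at h1
    rw [h, mul_zero] at h1
    have h3 : (ContinuousLinearMap.id ℝ F).det = 1 := LinearMap.det_id
    rw [h3] at h1
    exact zero_ne_one h1
  have hc : Continuous fun t => (fderiv ℝ (hb.flow hα s t) x).det :=
    ContinuousLinearMap.continuous_det.comp ((hb.continuous_fderiv_flow_initial hα s).comp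
      (continuous_id.prodMk continuous_const))
  have hs : (fderiv ℝ (hb.flow hα s s) x).det = 1 := by
    have : hb.flow hα s s = id := funext fun y => hb.flow_self hα s y
    rw [this, fderiv_id]
    exact LinearMap.det_id
  by_contra hn
  have := (isPreconnected_univ (α := ℝ)).intermediate_value (mem_univ t) (mem_univ s)
    hc.continuousOn
  obtain ⟨r, -, hr⟩ := this ⟨not_lt.1 hn, hs.symm ▸ zero_le_one⟩
  exact hne r hr

theorem ae_hasDerivAt_flow (s : ℝ) (x : F) :
    ∀ᵐ t, HasDerivAt (fun t => hb.flow hα t s x) (b t (hb.flow hα t s x)) t := by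
  filter_upwards [_root_.LocallyIntegrable.ae_hasDerivAt_integral
    (hb.integrable_flow hα s x).locallyIntegrable] with t ht
  refine ((ht s).const_add x).congr_of_eventuallyEq (Eventually.of_forall fun r => ?_)
  exact hb.flow_eq hα r s x

theorem absolutelyContinuousOnInterval_flow (s : ℝ) (x : F) (a c : ℝ) :
    AbsolutelyContinuousOnInterval (fun t => hb.flow hα t s x) a c := by
  refine absolutelyContinuousOnInterval_of_dist_le (K := 1)
    (absolutelyContinuousOnInterval_primitive (hb.integrable_flow hα s x) s a c)
    fun t _ t' _ => le_of_eq ?_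
  rw [one_mul, hb.flow_eq hα t s x, hb.flow_eq hα t' s x, dist_add_left]

/-- An absolutely continuous integral curve on `[0,T]` is given by the flow. -/
theorem eq_flow_of_absolutelyContinuous {T : ℝ} (hT : 0 ≤ T) (h0 : ∀ t ∉ Ioc 0 T, ∀ x, b t x = 0)
    {Y : ℝ → F} (hY : AbsolutelyContinuousOnInterval Y 0 T)
    (hd : ∀ᵐ t, t ∈ Icc 0 T → HasDerivAt Y (b t (Y t)) t) {s : ℝ} (hs : s ∈ Icc 0 T)
    {t : ℝ} (ht : t ∈ Icc 0 T) : Y t = hb.flow hα t s (Y s) := by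
  rw [← uIcc_of_le hT] at hd
  -- Time is clamped to `[0,T]`: `Y ∘ c` is a continuous curve on `ℝ`, and it solves the integral
  -- equation at all times because `b` vanishes between `c t` and `t`.
  set c : ℝ → ℝ := fun t => max 0 (min T t) with hc
  have hcmem : ∀ t, c t ∈ uIcc 0 T := fun t => by
    rw [uIcc_of_le hT]; exact ⟨le_max_left _ _, max_le hT (min_le_left _ _)⟩
  have hcid : ∀ t ∈ uIcc 0 T, c t = t := fun t ht => by
    rw [uIcc_of_le hT] at ht
    simp [hc, ht.1, ht.2]
  have hγ : Continuous (Y ∘ c) := hY.continuousOn.comp_continuous (by fun_prop) hcmem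
  rw [← uIcc_of_le hT] at hs ht
  have key := hb.eq_flow hα hγ (s := s) (x := Y s) (fun t => ?_) t
  · rwa [Function.comp_apply, hcid t ht] at key
  have hint := hb.integrable_comp hγ
  have h1 := sub_eq_integral_of_absolutelyContinuous hY hint (by
    filter_upwards [hd] with t h ht
    rw [Function.comp_apply, hcid t ht]
    exact h ht) hs (hcmem t)
  have h2 : ∫ r in c t..t, b r ((Y ∘ c) r) = 0 := by
    refine intervalIntegral.integral_zero_ae (Eventually.of_forall fun r hr => h0 r ?_ _)
    rintro ⟨hr0, hrT⟩
    rw [mem_uIoc, hc] at hr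
    grind
  rw [← intervalIntegral.integral_add_adjacent_intervals (b := c t) hint.intervalIntegrable
    hint.intervalIntegrable, h2, ← h1]
  simp

end IsHolderField

end ContinuityEquation

/-! ### Transport of `L²` densities by the flow. -/

namespace ContinuityEquation

open Filter Topology BoundedContinuousFunction

theorem eventually_forall_dist_lt {X Y G : Type*} [TopologicalSpace X] [TopologicalSpace Y]
    [PseudoMetricSpace G] {h : X → Y → G} (hh : Continuous fun p : X × Y => h p.1 p.2) {K : Set Y}
    (hK : IsCompact K) (x₀ : X) {ε : ℝ} (hε : 0 < ε) :
    ∀ᶠ x in 𝓝 x₀, ∀ y ∈ K, dist (h x y) (h x₀ y) < ε := by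
  refine hK.eventually_forall_of_forall_eventually fun y _ => ?_
  have hc : Continuous fun p : X × Y => dist (h p.1 p.2) (h x₀ p.2) :=
    hh.dist (hh.comp (continuous_const.prodMk continuous_snd))
  exact hc.continuousAt.eventually_lt continuousAt_const (by simpa using hε)

namespace IsHolderField

variable {n : ℕ} {Ω : Set (E n)} {α : ℝ≥0} {m : ℝ → ℝ} {b : ℝ → E n → E n}
  (hb : IsHolderField α m b) (hα : 0 < α)

theorem image_flow_eq (h0 : ∀ t, ∀ x ∉ Ω, b t x = 0) (t s : ℝ) :
    hb.flow hα t s '' Ω = Ω := by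
  refine Subset.antisymm (image_subset_iff.2 fun x hx => hb.flow_mem hα h0 t s hx) fun x hx => ?_
  exact ⟨hb.flow hα s t x, hb.flow_mem hα h0 s t hx, hb.flow_flow_cancel hα s t x⟩

theorem injective_flow (t s : ℝ) : Function.Injective (hb.flow hα t s) :=
  Function.LeftInverse.injective (hb.flow_flow_cancel hα t s)

theorem setIntegral_comp_flow (hΩ : IsOpen Ω) (h0 : ∀ t, ∀ x ∉ Ω, b t x = 0) (t s : ℝ)
    (g : E n → ℝ) :
    ∫ x in Ω, (fderiv ℝ (hb.flow hα t s) x).det * g (hb.flow hα t s x) = ∫ x in Ω, g x := by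
  have h := integral_image_eq_integral_abs_det_fderiv_smul volume hΩ.measurableSet
    (fun x _ => (hb.hasFDerivAt_flow hα t s x).hasFDerivWithinAt)
    (hb.injective_flow hα t s).injOn g
  rw [hb.image_flow_eq hα h0] at h
  rw [h]
  simp_rw [abs_of_pos (hb.det_fderiv_flow_pos hα s t _), smul_eq_mul]

theorem setLIntegral_comp_flow (hΩ : IsOpen Ω) (h0 : ∀ t, ∀ x ∉ Ω, b t x = 0) (t s : ℝ)
    (g : E n → ℝ≥0∞) :
    ∫⁻ x in Ω, ENNReal.ofReal (fderiv ℝ (hb.flow hα t s) x).det * g (hb.flow hα t s x)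
      = ∫⁻ x in Ω, g x := by
  have h := lintegral_image_eq_lintegral_abs_det_fderiv_mul volume hΩ.measurableSet
    (fun x _ => (hb.hasFDerivAt_flow hα t s x).hasFDerivWithinAt)
    (hb.injective_flow hα t s).injOn g
  rw [hb.image_flow_eq hα h0] at h
  rw [h]
  simp_rw [abs_of_pos (hb.det_fderiv_flow_pos hα s t _)]

/-- Change of variables for the indicator of a null set `N` shows that a positive density has zero
integral over the preimage of `N`. Hence composing an `L²` class with the flow is meaningful. -/
theorem quasiMeasurePreserving_flow (hΩ : IsOpen Ω) (h0 : ∀ t, ∀ x ∉ Ω, b t x = 0) (t s : ℝ) :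
    Measure.QuasiMeasurePreserving (hb.flow hα t s) (volume.restrict Ω) (volume.restrict Ω) := by
  have hc := (hb.contDiff_flow hα t s).continuous
  refine ⟨hc.measurable, Measure.AbsolutelyContinuous.mk fun N hN hN0 => ?_⟩
  rw [Measure.map_apply hc.measurable hN]
  have h1 := hb.setLIntegral_comp_flow hα hΩ h0 t s (N.indicator 1)
  rw [lintegral_indicator_one hN, hN0, lintegral_eq_zero_iff] at h1
  · rw [measure_eq_zero_iff_ae_notMem]
    filter_upwards [h1] with x hx hxN
    have hp := hb.det_fderiv_flow_pos hα s t x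
    have : ENNReal.ofReal (fderiv ℝ (hb.flow hα t s) x).det = 0 := by
      simpa [indicator_of_mem (s := N) (a := hb.flow hα t s x) hxN] using hx
    rw [ENNReal.ofReal_eq_zero] at this
    exact absurd hp (not_lt.2 this)
  · refine Measurable.mul ?_ ((measurable_one.indicator hN).comp hc.measurable)
    exact (ContinuousLinearMap.continuous_det.comp
      ((hb.contDiff_flow hα t s).continuous_fderiv one_ne_zero)).measurable.ennreal_ofReal

theorem continuous_det_fderiv_flow (s : ℝ) :
    Continuous fun p : ℝ × E n => (fderiv ℝ (hb.flow hα s p.1) p.2).det :=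
  ContinuousLinearMap.continuous_det.comp (hb.continuous_fderiv_flow_initial hα s)

theorem exists_det_fderiv_flow_le (hΩb : Bornology.IsBounded Ω) (s T : ℝ) :
    ∃ K : ℝ, 0 ≤ K ∧
      ∀ t ∈ Icc 0 T, ∀ x ∈ Ω, (fderiv ℝ (hb.flow hα s t) x).det ≤ K := by
  obtain ⟨K, hK⟩ := (isCompact_Icc.prod hΩb.isCompact_closure).exists_bound_of_continuousOn
    (s := Icc 0 T ×ˢ closure Ω) (hb.continuous_det_fderiv_flow hα s).continuousOn
  refine ⟨|K|, abs_nonneg _, fun t ht x hx => ?_⟩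
  exact (le_abs_self _).trans ((hK (t, x) ⟨ht, subset_closure hx⟩).trans (le_abs_self _))

/-- The transport of a density by the flow. -/
noncomputable def transport (t : ℝ) (g : E n → ℝ) (x : E n) : ℝ :=
  (fderiv ℝ (hb.flow hα 0 t) x).det * g (hb.flow hα 0 t x)

theorem aestronglyMeasurable_transport (hΩ : IsOpen Ω) (h0 : ∀ t, ∀ x ∉ Ω, b t x = 0) (t : ℝ)
    {g : E n → ℝ} (hg : AEStronglyMeasurable g (volume.restrict Ω)) :
    AEStronglyMeasurable (hb.transport hα t g) (volume.restrict Ω) :=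
  ((hb.continuous_det_fderiv_flow hα 0).comp
    (continuous_const.prodMk continuous_id)).aestronglyMeasurable.mul
    (hg.comp_quasiMeasurePreserving (hb.quasiMeasurePreserving_flow hα hΩ h0 0 t))

/-- In `det² |g(X)|²` one factor `det` is bounded by `K`; the other is the Jacobian of the change of
variables. -/
theorem eLpNorm_transport_le (hΩ : IsOpen Ω) (h0 : ∀ t, ∀ x ∉ Ω, b t x = 0) {t K : ℝ}
    (hK : ∀ x ∈ Ω, (fderiv ℝ (hb.flow hα 0 t) x).det ≤ K) (g : E n → ℝ) :
    eLpNorm (hb.transport hα t g) 2 (volume.restrict Ω)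
      ≤ ENNReal.ofReal K ^ (1 / 2 : ℝ) * eLpNorm g 2 (volume.restrict Ω) := by
  rw [eLpNorm_eq_lintegral_rpow_enorm_toReal two_ne_zero ENNReal.ofNat_ne_top,
    eLpNorm_eq_lintegral_rpow_enorm_toReal two_ne_zero ENNReal.ofNat_ne_top,
    ENNReal.toReal_ofNat, ← ENNReal.mul_rpow_of_nonneg _ _ (by norm_num)]
  refine ENNReal.rpow_le_rpow ?_ (by norm_num)
  rw [← hb.setLIntegral_comp_flow hα hΩ h0 0 t (fun y => ‖g y‖ₑ ^ (2 : ℝ)), ← lintegral_const_mul' _ _ ENNReal.ofReal_ne_top]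
  refine setLIntegral_mono' hΩ.measurableSet fun x hx => ?_
  have hp := (hb.det_fderiv_flow_pos hα t 0 x).le
  rw [transport, enorm_mul, Real.enorm_of_nonneg hp, ENNReal.mul_rpow_of_nonneg _ _ (by norm_num)]
  simp only [ENNReal.rpow_ofNat]
  rw [sq (ENNReal.ofReal _), ← mul_assoc]
  gcongr
  exact hK x hx

theorem memLp_transport (hΩ : IsOpen Ω) (hΩb : Bornology.IsBounded Ω)
    (h0 : ∀ t, ∀ x ∉ Ω, b t x = 0) {t : ℝ} (ht : 0 ≤ t) {g : E n → ℝ}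
    (hg : MemLp g 2 (volume.restrict Ω)) :
    MemLp (hb.transport hα t g) 2 (volume.restrict Ω) := by
  obtain ⟨K, -, hK⟩ := hb.exists_det_fderiv_flow_le hα hΩb 0 t
  refine ⟨hb.aestronglyMeasurable_transport hα hΩ h0 t hg.1,
    (hb.eLpNorm_transport_le hα hΩ h0 (hK t (right_mem_Icc.2 ht)) g).trans_lt ?_⟩
  exact ENNReal.mul_lt_top (ENNReal.rpow_lt_top_of_nonneg (by norm_num) ENNReal.ofReal_ne_top) hg.2

/-- For continuous `g` the transported density is jointly continuous, so it varies uniformly on the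
compact closure of `Ω`, and `Ω` has finite measure. -/
theorem continuous_toLp_transport_of_bounded (hΩ : IsOpen Ω) (hΩb : Bornology.IsBounded Ω)
    (h0 : ∀ t, ∀ x ∉ Ω, b t x = 0) {T : ℝ} {g : E n → ℝ} (hgc : Continuous g)
    (hg : MemLp g 2 (volume.restrict Ω)) :
    Continuous fun t : Icc (0 : ℝ) T => (hb.memLp_transport hα hΩ hΩb h0 t.2.1 hg).toLp := by
  have hfin : volume Ω ≠ ⊤ := hΩb.measure_lt_top.ne
  have hjc : Continuous fun p : ℝ × E n => hb.transport hα p.1 g p.2 :=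
    (hb.continuous_det_fderiv_flow hα 0).mul (hgc.comp (hb.continuous_flow_initial hα 0))
  rw [continuous_iff_continuousAt]
  intro t
  rw [ContinuousAt, EMetric.tendsto_nhds]
  intro ε hε
  obtain ⟨δ, hδ, hδε⟩ : ∃ δ : ℝ, 0 < δ ∧
      (volume.restrict Ω) univ ^ (1 / 2 : ℝ) * ENNReal.ofReal δ < ε := by
    have hlim : Tendsto (fun δ : ℝ => (volume.restrict Ω) univ ^ (1 / 2 : ℝ) * ENNReal.ofReal δ)
        (𝓝[>] 0) (𝓝 0) := by
      have h1 : Tendsto (fun δ : ℝ => ENNReal.ofReal δ) (𝓝[>] 0) (𝓝 0) := by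
        simpa using (ENNReal.continuous_ofReal.tendsto 0).mono_left nhdsWithin_le_nhds
      have h2 := ENNReal.Tendsto.const_mul (a := (volume.restrict Ω) univ ^ (1 / 2 : ℝ)) h1
        (Or.inr (ENNReal.rpow_ne_top_of_nonneg (by norm_num) (by simpa using hfin)))
      simpa using h2
    obtain ⟨δ, h1, h2⟩ := ((hlim.eventually_lt_const hε).and self_mem_nhdsWithin).exists
    exact ⟨δ, h2, h1⟩
  have hev := eventually_forall_dist_lt (h := fun t x => hb.transport hα t g x) hjc
    hΩb.isCompact_closure t.1 hδ
  filter_upwards [continuous_subtype_val.continuousAt.eventually hev] with r hr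
  rw [Lp.edist_toLp_toLp]
  refine lt_of_le_of_lt ?_ hδε
  refine (eLpNorm_le_of_ae_bound (C := δ) ?_).trans (by simp)
  filter_upwards [ae_restrict_mem hΩ.measurableSet] with x hx
  exact (hr x (subset_closure hx)).le

/-- Bounded continuous functions are dense in `L²` and the transport operators are bounded uniformly
on `[0,T]`, so the curve is a uniform limit of continuous ones. -/
theorem continuous_toLp_transport (hΩ : IsOpen Ω) (hΩb : Bornology.IsBounded Ω)
    (h0 : ∀ t, ∀ x ∉ Ω, b t x = 0) {T : ℝ} {g : E n → ℝ} (hg : MemLp g 2 (volume.restrict Ω)) :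
    Continuous fun t : Icc (0 : ℝ) T => (hb.memLp_transport hα hΩ hΩb h0 t.2.1 hg).toLp := by
  have hfin : volume Ω ≠ ⊤ := hΩb.measure_lt_top.ne
  have : IsFiniteMeasure (volume.restrict Ω) := ⟨by simpa using hfin.lt_top⟩
  obtain ⟨K, -, hK⟩ := hb.exists_det_fderiv_flow_le hα hΩb 0 T
  refine continuous_of_uniform_approx_of_continuous fun u hu => ?_
  obtain ⟨ε, hε, hεu⟩ := mem_uniformity_edist.1 hu
  have hKtop : ENNReal.ofReal K ^ (1 / 2 : ℝ) ≠ ⊤ :=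
    ENNReal.rpow_ne_top_of_nonneg (by norm_num) ENNReal.ofReal_ne_top
  obtain ⟨δ, hδ, hδε⟩ : ∃ δ : ℝ≥0∞, 0 < δ ∧ ENNReal.ofReal K ^ (1 / 2 : ℝ) * δ < ε := by
    have hlim : Tendsto (fun δ : ℝ≥0∞ => ENNReal.ofReal K ^ (1 / 2 : ℝ) * δ) (𝓝[>] 0) (𝓝 0) := by
      have h2 := ENNReal.Tendsto.const_mul (a := ENNReal.ofReal K ^ (1 / 2 : ℝ))
        (tendsto_id (α := ℝ≥0∞) (x := 𝓝 0)) (Or.inr hKtop)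
      simpa using h2.mono_left nhdsWithin_le_nhds
    obtain ⟨δ, h1, h2⟩ := ((hlim.eventually_lt_const hε).and self_mem_nhdsWithin).exists
    exact ⟨δ, h2, h1⟩
  obtain ⟨k, hk, hkL⟩ := hg.exists_boundedContinuous_eLpNorm_sub_le ENNReal.ofNat_ne_top hδ.ne'
  refine ⟨_, hb.continuous_toLp_transport_of_bounded hα hΩ hΩb h0 k.continuous hkL, fun t => ?_⟩
  refine hεu ?_
  rw [Lp.edist_toLp_toLp]
  refine lt_of_le_of_lt ?_ hδε
  have hsub : hb.transport hα t g - hb.transport hα t k = hb.transport hα t (g - k) := by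
    ext x
    simp [transport, mul_sub]
  rw [hsub]
  refine (hb.eLpNorm_transport_le hα hΩ h0 (hK t t.2) _).trans ?_
  gcongr

/-- The transported density as a continuous curve in `L²`. -/
noncomputable def transportL2 (hΩ : IsOpen Ω) (hΩb : Bornology.IsBounded Ω)
    (h0 : ∀ t, ∀ x ∉ Ω, b t x = 0) (T : ℝ) (f₀ : L2 Ω) : C(Icc (0 : ℝ) T, L2 Ω) :=
  ⟨fun t => (hb.memLp_transport hα hΩ hΩb h0 t.2.1 (Lp.memLp f₀)).toLp,
    hb.continuous_toLp_transport hα hΩ hΩb h0 (Lp.memLp f₀)⟩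

theorem transportL2_ae_eq (hΩ : IsOpen Ω) (hΩb : Bornology.IsBounded Ω)
    (h0 : ∀ t, ∀ x ∉ Ω, b t x = 0) {T : ℝ} (f₀ : L2 Ω) (t : Icc (0 : ℝ) T) :
    hb.transportL2 hα hΩ hΩb h0 T f₀ t =ᵐ[volume.restrict Ω] hb.transport hα t f₀ :=
  (hb.memLp_transport hα hΩ hΩb h0 t.2.1 (Lp.memLp f₀)).coeFn_toLp

/-- The transported density is the image of `g dx` under `X(t,0,·)`. This duality serves both
existence and uniqueness. -/
theorem setIntegral_transport_mul (hΩ : IsOpen Ω) (h0 : ∀ t, ∀ x ∉ Ω, b t x = 0) (t : ℝ)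
    (g ψ : E n → ℝ) :
    ∫ x in Ω, hb.transport hα t g x * ψ x = ∫ y in Ω, g y * ψ (hb.flow hα t 0 y) := by
  rw [← hb.setIntegral_comp_flow hα hΩ h0 0 t fun y => g y * ψ (hb.flow hα t 0 y)]
  simp only [flow_flow_cancel, transport, mul_assoc]

theorem setIntegral_transportL2_mul (hΩ : IsOpen Ω) (hΩb : Bornology.IsBounded Ω)
    (h0 : ∀ t, ∀ x ∉ Ω, b t x = 0) {T : ℝ} (f₀ : L2 Ω) (t : Icc (0 : ℝ) T) (ψ : E n → ℝ) :
    ∫ x in Ω, hb.transportL2 hα hΩ hΩb h0 T f₀ t x * ψ x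
      = ∫ y in Ω, f₀ y * ψ (hb.flow hα t 0 y) := by
  rw [← hb.setIntegral_transport_mul hα hΩ h0]
  refine integral_congr_ae ?_
  filter_upwards [hb.transportL2_ae_eq hα hΩ hΩb h0 f₀ t] with x hx
  rw [hx]

end IsHolderField

end ContinuityEquation

/-! ### The transported density is a weak solution. -/

namespace ContinuityEquation

open Filter Topology BoundedContinuousFunction

/-- Fundamental theorem of calculus for absolutely continuous vector-valued functions, with a
derivative that is integrable on the interval. -/
theorem sub_eq_integral_of_absolutelyContinuous_of_intervalIntegrable {F : Type*}
    [NormedAddCommGroup F] [NormedSpace ℝ F] [CompleteSpace F] {f g : ℝ → F} {a b : ℝ}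
    (hf : AbsolutelyContinuousOnInterval f a b) (hg : IntervalIntegrable g volume a b)
    (h : ∀ᵐ t, t ∈ uIcc a b → HasDerivAt f (g t) t) : f b - f a = ∫ r in a..b, g r := by
  have hg' : Integrable ((uIcc a b).indicator g) :=
    (integrable_indicator_iff measurableSet_uIcc).2 ((intervalIntegrable_iff' (by simp)).1 hg)
  rw [sub_eq_integral_of_absolutelyContinuous hf hg' ?_ left_mem_uIcc right_mem_uIcc]
  · exact intervalIntegral.integral_congr fun r hr => indicator_of_mem hr g
  · filter_upwards [h] with t ht htm
    rw [indicator_of_mem htm]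
    exact ht htm

section TestFunctions

variable {n : ℕ} {Ω : Set (E n)} {T : ℝ}

theorem IsTestFunction.hasFDerivAt {G F : Type*} [NormedAddCommGroup G] [NormedSpace ℝ G]
    [NormedAddCommGroup F] [NormedSpace ℝ F] {U : Set G} {φ : G → F} (hφ : IsTestFunction U φ)
    (x : G) : HasFDerivAt φ (fderiv ℝ φ x) x :=
  (hφ.1.differentiable (by simp) x).hasFDerivAt

theorem IsTestFunction.continuous_fderiv {G F : Type*} [NormedAddCommGroup G] [NormedSpace ℝ G]
    [NormedAddCommGroup F] [NormedSpace ℝ F] {U : Set G} {φ : G → F} (hφ : IsTestFunction U φ) :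
    Continuous (fderiv ℝ φ) :=
  hφ.1.continuous_fderiv (by simp)

theorem IsTestFunction.exists_norm_fderiv_le {G F : Type*} [NormedAddCommGroup G] [NormedSpace ℝ G]
    [NormedAddCommGroup F] [NormedSpace ℝ F] {U : Set G} {φ : G → F} (hφ : IsTestFunction U φ) :
    ∃ K : ℝ, 0 ≤ K ∧ ∀ x, ‖fderiv ℝ φ x‖ ≤ K := by
  obtain ⟨K, hK⟩ := (hφ.2.1.fderiv (𝕜 := ℝ)).exists_bound_of_continuous hφ.continuous_fderiv
  exact ⟨K, (norm_nonneg _).trans (hK 0), hK⟩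

theorem IsTestFunction.inner_gradient_add_deriv {U : Set (ℝ × E n)} {η : ℝ × E n → ℝ}
    (hη : IsTestFunction U η) (t : ℝ) (x u : E n) :
    inner ℝ u (gradient (fun y => η (t, y)) x) + deriv (fun s => η (s, x)) t
      = fderiv ℝ η (t, x) (1, u) := by
  have h1 : HasFDerivAt (fun y => η (t, y))
      ((fderiv ℝ η (t, x)).comp (ContinuousLinearMap.inr ℝ ℝ (E n))) x :=
    (hη.hasFDerivAt (t, x)).comp x (hasFDerivAt_prodMk_right t x)
  have h2 : HasDerivAt (fun s => η (s, x)) (fderiv ℝ η (t, x) (1, 0)) t :=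
    (hη.hasFDerivAt (t, x)).comp_hasDerivAt t ((hasDerivAt_id t).prodMk (hasDerivAt_const t x))
  rw [gradient, h1.fderiv, h2.deriv, real_inner_comm, InnerProductSpace.toDual_symm_apply,
    ContinuousLinearMap.comp_apply, ContinuousLinearMap.inr_apply, ← map_add]
  simp

/-- Two normalizations: the integrand is the derivative of `η` in the direction `(1, b)`, and `f` is
extended to all times by its endpoint values. -/
theorem isWeakSolution_iff (hT : 0 ≤ T) {b : ℝ → E n → E n} {f₀ : L2 Ω}
    {f : C(Icc (0 : ℝ) T, L2 Ω)} :
    IsWeakSolution T Ω b f₀ f ↔ ∀ η : ℝ × E n → ℝ, IsTestFunction (Iio T ×ˢ Ω) η →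
      (∫ t in Icc 0 T, ∫ x in Ω, f (projIcc 0 T hT t) x * fderiv ℝ η (t, x) (1, b t x))
        + ∫ x in Ω, f₀ x * η (0, x) = 0 := by
  refine forall₂_congr fun η hη => ?_
  simp_rw [hη.inner_gradient_add_deriv]
  rw [← integral_subtype_comap measurableSet_Icc fun t =>
    ∫ x in Ω, f (projIcc 0 T hT t) x * fderiv ℝ η (t, x) (1, b t x)]
  simp_rw [projIcc_val]

theorem isWeakSolution_congr (hT : 0 ≤ T) {b b' : ℝ → E n → E n}
    (h : ∀ᵐ t ∂(volume.restrict (Icc 0 T)), b t = b' t) {f₀ : L2 Ω}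
    {f : C(Icc (0 : ℝ) T, L2 Ω)} :
    IsWeakSolution T Ω b f₀ f ↔ IsWeakSolution T Ω b' f₀ f := by
  rw [isWeakSolution_iff hT, isWeakSolution_iff hT]
  refine forall₂_congr fun η hη => ?_
  rw [integral_congr_ae]
  filter_upwards [h] with t ht
  rw [ht]

theorem integrable_coeFn (hΩb : Bornology.IsBounded Ω) (g : L2 Ω) :
    Integrable g (volume.restrict Ω) := by
  have : IsFiniteMeasure (volume.restrict Ω) := ⟨by simpa using hΩb.measure_lt_top⟩
  exact (Lp.memLp g).integrable (by norm_num)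

end TestFunctions

section Existence

variable {n : ℕ} {Ω : Set (E n)} {α : ℝ≥0} {T : ℝ} {V : Type*} [NormedAddCommGroup V]
  [NormedSpace ℝ V] {ι : V →ₗ[ℝ] (E n → E n)} {C : ℝ} {v : ℝ → V}

/-- `η` is Lipschitz, and the increments of `(t, X(t,s,y))` are dominated by those of `t + ∫ₛᵗ m`,
whose two terms both increase, so their increments add in absolute value. -/
theorem IsHolderField.absolutelyContinuous_comp_flow {m : ℝ → ℝ} {b : ℝ → E n → E n}
    (hb : IsHolderField α m b) (hα : 0 < α) {U : Set (ℝ × E n)} {η : ℝ × E n → ℝ}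
    (hη : IsTestFunction U η) (s : ℝ) (y : E n) (a c : ℝ) :
    AbsolutelyContinuousOnInterval (fun t => η (t, hb.flow hα t s y)) a c := by
  obtain ⟨K, hK⟩ := (hη.1.of_le (m := 1) (by simp)).lipschitzWith_of_hasCompactSupport
    hη.2.1 one_ne_zero
  have hid : AbsolutelyContinuousOnInterval (fun t : ℝ => t) a c :=
    (LipschitzWith.id.lipschitzOnWith (s := uIcc a c)).absolutelyContinuousOnInterval
  refine absolutelyContinuousOnInterval_of_dist_le (K := K)
    (hid.add (absolutelyContinuousOnInterval_primitive hb.integrable s a c)) fun t _ t' _ => ?_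
  refine (hK.dist_le_mul _ _).trans (mul_le_mul_of_nonneg_left ?_ K.coe_nonneg)
  have hflow := hb.norm_flow_sub_flow_le hα t t' s y
  rw [Prod.dist_eq, dist_eq_norm (hb.flow hα t s y), Real.dist_eq, Real.dist_eq, Pi.add_apply,
    Pi.add_apply, add_sub_add_comm, intervalIntegral.integral_interval_sub_left
    hb.integrable.intervalIntegrable hb.integrable.intervalIntegrable]
  have hsign : |t - t' + ∫ r in t'..t, m r| = |t - t'| + |∫ r in t'..t, m r| := by
    rcases le_total t' t with h | h
    · have := intervalIntegral.integral_nonneg (μ := volume) h fun r _ => hb.nonneg r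
      rw [abs_of_nonneg (sub_nonneg.2 h), abs_of_nonneg this,
        abs_of_nonneg (add_nonneg (sub_nonneg.2 h) this)]
    · have := intervalIntegral.integral_nonneg (μ := volume) h fun r _ => hb.nonneg r
      rw [intervalIntegral.integral_symm] at this
      rw [abs_of_nonpos (sub_nonpos.2 h), abs_of_nonpos (by linarith),
        abs_of_nonpos (by linarith [sub_nonpos.2 h])]
      ring
  rw [hsign]
  exact max_le (le_add_of_nonneg_right (abs_nonneg _))
    (hflow.trans (le_add_of_nonneg_left (abs_nonneg _)))

/-- By the chain rule the integrand is almost everywhere the derivative of `η` along the trajectory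
from `y`, and `η` vanishes at time `T`. -/
theorem IsHolderField.setIntegral_fderiv_flow {m : ℝ → ℝ} {b : ℝ → E n → E n}
    (hb : IsHolderField α m b) (hα : 0 < α) (hT : 0 ≤ T) {η : ℝ × E n → ℝ}
    (hη : IsTestFunction (Iio T ×ˢ Ω) η) (y : E n) :
    ∫ t in Icc 0 T, fderiv ℝ η (t, hb.flow hα t 0 y) (1, b t (hb.flow hα t 0 y)) = -η (0, y) := by
  obtain ⟨K, hK0, hK⟩ := hη.exists_norm_fderiv_le
  have hY := hb.continuous_flow_time hα 0 y
  have hint : IntervalIntegrable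
      (fun t => fderiv ℝ η (t, hb.flow hα t 0 y) (1, b t (hb.flow hα t 0 y))) volume 0 T := by
    refine (((intervalIntegrable_const (c := (1 : ℝ))).add
      hb.integrable.intervalIntegrable).const_mul K).mono_fun' (g := fun t => K * (1 + m t))
      ?_ (Eventually.of_forall fun t => ?_)
    · refine AEStronglyMeasurable.restrict ?_
      exact (ContinuousLinearMap.apply ℝ ℝ).flip.aestronglyMeasurable_comp₂
        (hη.continuous_fderiv.comp (continuous_id.prodMk hY)).aestronglyMeasurable
        (aestronglyMeasurable_const.prodMk (hb.integrable_flow hα 0 y).1)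
    · refine (ContinuousLinearMap.le_opNorm _ _).trans (mul_le_mul (hK _) ?_ (norm_nonneg _) hK0)
      rw [Prod.norm_def]
      have h1 := hb.nonneg t
      refine max_le (by simpa using h1) ((hb.norm_le _ _).trans (by linarith))
  have hη0 : ∀ x, η (T, x) = 0 := fun x =>
    image_eq_zero_of_notMem_tsupport fun h => lt_irrefl T (hη.2.2 h).1
  rw [integral_Icc_eq_integral_Ioc, ← intervalIntegral.integral_of_le hT,
    ← sub_eq_integral_of_absolutelyContinuous_of_intervalIntegrable
      (hb.absolutelyContinuous_comp_flow hα hη 0 y 0 T) hint, hη0, IsHolderField.flow_self, zero_sub]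
  filter_upwards [hb.ae_hasDerivAt_flow hα 0 y] with t ht _
  exact (hη.hasFDerivAt _).comp_hasDerivAt t ((hasDerivAt_id t).prodMk ht)

/-- In the coordinates of the starting point the time dependence of `f` disappears, and after Fubini
the time integral is known for each `y`. Joint measurability in `(t, y)` comes from factoring the
field through `V`. -/
theorem IsHolderFamily.isWeakSolution_transportL2 (hι : IsHolderFamily Ω α C ι) (hα : 0 < α)
    (hv : Integrable v) (hΩ : IsOpen Ω) (hΩb : Bornology.IsBounded Ω) (hT : 0 ≤ T) (f₀ : L2 Ω) :
    IsWeakSolution T Ω (fun t => ι (v t)) f₀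
      ((hι.isHolderField hv).transportL2 hα hΩ hΩb (fun _ => hι.eq_zero _) T f₀) := by
  set hb := hι.isHolderField hv
  rw [isWeakSolution_iff hT]
  intro η hη
  obtain ⟨K, hK0, hK⟩ := hη.exists_norm_fderiv_le
  set θ : ℝ → E n → ℝ := fun t y =>
    fderiv ℝ η (t, hb.flow hα t 0 y) (1, ι (v t) (hb.flow hα t 0 y)) with hθ
  have hA : ∀ t ∈ Icc 0 T, (∫ x in Ω, hb.transportL2 hα hΩ hΩb (fun _ => hι.eq_zero _) T f₀
      (projIcc 0 T hT t) x * fderiv ℝ η (t, x) (1, ι (v t) x)) = ∫ y in Ω, f₀ y * θ t y := by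
    intro t ht
    rw [hb.setIntegral_transportL2_mul hα hΩ hΩb _ f₀ _ fun x => fderiv ℝ η (t, x) (1, ι (v t) x),
      projIcc_of_mem hT ht]
  have hint : Integrable (Function.uncurry fun t y => f₀ y * θ t y)
      ((volume.restrict (Icc 0 T)).prod (volume.restrict Ω)) := by
    have hdom : Integrable (fun p : ℝ × E n => (K * (1 + C * ‖v p.1‖)) * ‖f₀ p.2‖)
        ((volume.restrict (Icc 0 T)).prod (volume.restrict Ω)) :=
      Integrable.mul_prod (f := fun t => K * (1 + C * ‖v t‖)) (g := fun y => ‖f₀ y‖)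
        (((integrable_const (1 : ℝ)).add (hv.norm.const_mul C).restrict).const_mul K)
        (integrable_coeFn hΩb f₀).norm
    have hflow := hb.continuous_flow hα 0
    refine hdom.mono' ?_ (Eventually.of_forall fun p => ?_)
    · refine ((Lp.memLp f₀).1.comp_snd).mul ?_
      exact (ContinuousLinearMap.apply ℝ ℝ).flip.aestronglyMeasurable_comp₂
        (hη.continuous_fderiv.comp (continuous_fst.prodMk hflow)).aestronglyMeasurable
        (aestronglyMeasurable_const.prodMk (hι.continuous_uncurry.comp_aestronglyMeasurable
          (hv.1.restrict.comp_fst.prodMk hflow.aestronglyMeasurable)))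
    · rw [Function.uncurry, norm_mul, mul_comm]
      refine mul_le_mul_of_nonneg_right ?_ (norm_nonneg _)
      refine (ContinuousLinearMap.le_opNorm _ _).trans (mul_le_mul (hK _) ?_ (norm_nonneg _) hK0)
      rw [Prod.norm_def]
      have h1 := hb.nonneg p.1
      exact max_le (by simpa using h1) ((hι.norm_le _ _).trans (by linarith))
  rw [setIntegral_congr_fun measurableSet_Icc hA, integral_integral_swap hint]
  simp_rw [integral_const_mul, hθ, hb.setIntegral_fderiv_flow hα hT hη, mul_neg, integral_neg,
    neg_add_cancel]

end Existence

end ContinuityEquation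

/-! ### Mollification, time cutoffs and product test functions. -/

namespace ContinuityEquation

open Filter Topology BoundedContinuousFunction

section Approximation

variable {n : ℕ} {Ω : Set (E n)}

/-- `C¹` functions with compact support in `Ω`. -/
structure IsC1TestFunction (Ω : Set (E n)) (φ : E n → ℝ) : Prop where
  contDiff : ContDiff ℝ 1 φ
  hasCompactSupport : HasCompactSupport φ
  tsupport_subset : tsupport φ ⊆ Ω

theorem IsTestFunction.isC1TestFunction {φ : E n → ℝ} (hφ : IsTestFunction Ω φ) :
    IsC1TestFunction Ω φ :=
  ⟨hφ.1.of_le (by simp), hφ.2.1, hφ.2.2⟩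

namespace IsC1TestFunction

variable {φ : E n → ℝ}

theorem continuous_fderiv (hφ : IsC1TestFunction Ω φ) : Continuous (fderiv ℝ φ) :=
  hφ.contDiff.continuous_fderiv one_ne_zero

/-- Mollification: `C¹` test functions are limits of smooth ones in the `C¹` norm. -/
theorem exists_isTestFunction_near (hΩ : IsOpen Ω) (hφ : IsC1TestFunction Ω φ) {ε : ℝ}
    (hε : 0 < ε) : ∃ ψ : E n → ℝ, IsTestFunction Ω ψ ∧ (∀ x, ‖ψ x - φ x‖ ≤ ε) ∧
      ∀ x, ‖fderiv ℝ ψ x - fderiv ℝ φ x‖ ≤ ε := by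
  obtain ⟨δ₁, hδ₁, h₁⟩ := Metric.uniformContinuous_iff.1
    (hφ.hasCompactSupport.uniformContinuous_of_continuous hφ.contDiff.continuous) ε hε
  obtain ⟨δ₂, hδ₂, h₂⟩ := Metric.uniformContinuous_iff.1
    ((hφ.hasCompactSupport.fderiv (𝕜 := ℝ)).uniformContinuous_of_continuous
      hφ.continuous_fderiv) ε hε
  obtain ⟨δ₃, hδ₃, h₃⟩ := hφ.hasCompactSupport.isCompact.exists_cthickening_subset_open hΩ
    hφ.tsupport_subset
  set δ := min δ₁ (min δ₂ δ₃) with hδ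
  have hδ0 : 0 < δ := lt_min hδ₁ (lt_min hδ₂ hδ₃)
  let κ : ContDiffBump (0 : E n) := ⟨δ / 2, δ, half_pos hδ0, half_lt_self hδ0⟩
  set ψ : E n → ℝ := MeasureTheory.convolution (κ.normed volume) φ
    (ContinuousLinearMap.lsmul ℝ ℝ) volume with hψ
  have hint : LocallyIntegrable (κ.normed volume) volume :=
    κ.continuous_normed.locallyIntegrable
  have hsupp : Function.support ψ ⊆ Metric.cthickening δ (tsupport φ) := by
    refine (support_convolution_subset _).trans ?_
    rw [κ.support_normed_eq]
    rintro _ ⟨y, hy, z, hz, rfl⟩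
    refine Metric.mem_cthickening_of_dist_le _ z _ _ (subset_tsupport _ hz) ?_
    simpa [dist_eq_norm] using (mem_ball_zero_iff.1 hy).le
  have htsupp : tsupport ψ ⊆ Metric.cthickening δ (tsupport φ) :=
    closure_minimal hsupp Metric.isClosed_cthickening
  refine ⟨ψ, ⟨?_, ?_, ?_⟩, fun x => ?_, fun x => ?_⟩
  · exact κ.hasCompactSupport_normed.contDiff_convolution_left _ κ.contDiff_normed
      hφ.contDiff.continuous.locallyIntegrable
  · exact (hφ.hasCompactSupport.isCompact.cthickening).of_isClosed_subset
      (isClosed_tsupport _) htsupp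
  · exact htsupp.trans ((Metric.cthickening_mono
      ((min_le_right _ _).trans (min_le_right _ _)) _).trans h₃)
  · rw [← dist_eq_norm]
    refine κ.dist_normed_convolution_le hφ.contDiff.continuous.aestronglyMeasurable fun y hy => ?_
    exact (h₁ (lt_of_lt_of_le hy (min_le_left _ _))).le
  -- The derivative of the convolution falls on `φ`, so the estimate for values applies again, now
  -- to `fderiv ℝ φ`.
  · have hd := hφ.hasCompactSupport.hasFDerivAt_convolution_right
      (ContinuousLinearMap.lsmul ℝ ℝ) hint hφ.contDiff x
    have heq : MeasureTheory.convolution (κ.normed volume) (fderiv ℝ φ)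
        ((ContinuousLinearMap.lsmul ℝ ℝ).precompR (E n)) volume x
        = MeasureTheory.convolution (κ.normed volume) (fderiv ℝ φ)
        (ContinuousLinearMap.lsmul ℝ ℝ) volume x := by
      rw [convolution_def, convolution_def]
      refine integral_congr_ae (Eventually.of_forall fun y => ?_)
      ext z
      simp [ContinuousLinearMap.precompR_apply]
    rw [hd.fderiv, heq, ← dist_eq_norm]
    refine κ.dist_normed_convolution_le hφ.continuous_fderiv.aestronglyMeasurable fun y hy => ?_
    exact (h₂ (lt_of_lt_of_le hy ((min_le_right _ _).trans (min_le_left _ _)))).le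

end IsC1TestFunction

/-- A smooth function of time that equals `1` on `[0,t]` and `0` on `[t+ε,∞)`. -/
theorem exists_time_cutoff {t ε : ℝ} (hε : 0 < ε) :
    ∃ χ : ℝ → ℝ, ContDiff ℝ ∞ χ ∧ tsupport χ ⊆ Icc (-2) (t + ε) ∧ (∀ r, χ r ∈ Icc 0 1) ∧
      (∀ r ∈ Icc 0 t, χ r = 1) ∧ (∀ r, t + ε ≤ r → χ r = 0) ∧
      (∀ r, 0 ≤ r → deriv χ r ≤ 0) ∧ ∀ r, 0 ≤ r → r ∉ Icc t (t + ε) → deriv χ r = 0 := by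
  set ρ : ℝ → ℝ := fun r => Real.smoothTransition ((t + ε - r) / ε) with hρ
  -- The second factor vanishes for `r ≤ -2` and is `1` for `r ≥ -1`; it makes the support compact
  -- without affecting times `r ≥ 0`.
  set χ : ℝ → ℝ := fun r => ρ r * Real.smoothTransition (r + 2) with hχ
  have hρanti : Antitone ρ := fun r s hrs => Real.smoothTransition.monotone (by gcongr)
  have hρ1 : ∀ r ≤ t, ρ r = 1 := fun r hr =>
    Real.smoothTransition.one_of_one_le ((one_le_div hε).2 (by linarith))
  have hρ0 : ∀ r, t + ε ≤ r → ρ r = 0 := fun r hr =>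
    Real.smoothTransition.zero_of_nonpos (div_nonpos_of_nonpos_of_nonneg (by linarith) hε.le)
  have hχρ : ∀ r, -1 ≤ r → χ r = ρ r := fun r hr => by
    simp only [hχ]
    rw [Real.smoothTransition.one_of_one_le (by linarith), mul_one]
  have hχρ' : ∀ r, 0 ≤ r → χ =ᶠ[𝓝 r] ρ := fun r hr => by
    filter_upwards [lt_mem_nhds (show -1 < r by linarith)] with s hs using hχρ s hs.le
  refine ⟨χ, ?_, ?_, fun r => ⟨?_, ?_⟩, fun r hr => ?_, fun r hr => ?_, fun r hr => ?_,
    fun r hr hrI => ?_⟩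
  · refine ContDiff.mul ?_ ?_
    · exact Real.smoothTransition.contDiff.comp ((contDiff_const.sub contDiff_id).div_const ε)
    · exact Real.smoothTransition.contDiff.comp (contDiff_id.add contDiff_const)
  · refine closure_minimal (fun r hr => ?_) isClosed_Icc
    by_contra hn
    refine hr ?_
    rw [mem_Icc, not_and_or, not_le, not_le] at hn
    rcases hn with h | h
    · simp only [hχ]
      rw [Real.smoothTransition.zero_of_nonpos (x := r + 2) (by linarith), mul_zero]
    · simp only [hχ]
      rw [hρ0 r h.le, zero_mul]
  · exact mul_nonneg (Real.smoothTransition.nonneg _) (Real.smoothTransition.nonneg _)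
  · exact mul_le_one₀ (Real.smoothTransition.le_one _) (Real.smoothTransition.nonneg _)
      (Real.smoothTransition.le_one _)
  · rw [hχρ r (by linarith [hr.1]), hρ1 r hr.2]
  · simp only [hχ]
    rw [hρ0 r hr, zero_mul]
  · rw [(hχρ' r hr).deriv_eq]
    exact hρanti.deriv_nonpos
  · rw [(hχρ' r hr).deriv_eq]
    rw [mem_Icc, not_and_or, not_le, not_le] at hrI
    rcases hrI with h | h
    · have : ρ =ᶠ[𝓝 r] fun _ => 1 := by
        filter_upwards [gt_mem_nhds h] with s hs using hρ1 s hs.le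
      rw [this.deriv_eq, deriv_const]
    · have : ρ =ᶠ[𝓝 r] fun _ => 0 := by
        filter_upwards [lt_mem_nhds h] with s hs using hρ0 s hs.le
      rw [this.deriv_eq, deriv_const]

theorem isTestFunction_mul {T : ℝ} {χ : ℝ → ℝ} (hχ : ContDiff ℝ ∞ χ) {a c : ℝ}
    (hχs : tsupport χ ⊆ Icc a c) (hc : c < T) {φ : E n → ℝ} (hφ : IsTestFunction Ω φ) :
    IsTestFunction (Iio T ×ˢ Ω) fun p : ℝ × E n => χ p.1 * φ p.2 := by
  have hsub : tsupport (fun p : ℝ × E n => χ p.1 * φ p.2) ⊆ tsupport χ ×ˢ tsupport φ := by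
    refine closure_minimal (fun p hp => ?_) ((isClosed_tsupport _).prod (isClosed_tsupport _))
    exact ⟨subset_tsupport _ (left_ne_zero_of_mul hp), subset_tsupport _ (right_ne_zero_of_mul hp)⟩
  refine ⟨(hχ.comp contDiff_fst).mul (hφ.1.comp contDiff_snd), ?_, ?_⟩
  · exact ((isCompact_Icc.of_isClosed_subset (isClosed_tsupport _) hχs).prod
      hφ.2.1.isCompact).of_isClosed_subset (isClosed_tsupport _) hsub
  · exact hsub.trans (prod_mono (hχs.trans fun r hr => lt_of_le_of_lt hr.2 hc) hφ.2.2)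

theorem fderiv_mul_apply_one {χ : ℝ → ℝ} (hχ : ContDiff ℝ ∞ χ) {φ : E n → ℝ}
    (hφ : IsTestFunction Ω φ) (r : ℝ) (x u : E n) :
    fderiv ℝ (fun p : ℝ × E n => χ p.1 * φ p.2) (r, x) (1, u)
      = deriv χ r * φ x + χ r * fderiv ℝ φ x u := by
  have h1 : HasFDerivAt (fun p : ℝ × E n => χ p.1) _ (r, x) :=
    ((hχ.differentiable (by simp) r).hasDerivAt.hasFDerivAt).comp (r, x) hasFDerivAt_fst
  have h2 : HasFDerivAt (fun p : ℝ × E n => φ p.2) _ (r, x) :=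
    (hφ.hasFDerivAt x).comp (r, x) hasFDerivAt_snd
  rw [(h1.fun_mul h2).fderiv]
  simp
  ring

end Approximation

end ContinuityEquation

/-! ### The weak equation integrated in time. -/

namespace ContinuityEquation

open Filter Topology BoundedContinuousFunction

/-- A continuous function with integrable weak derivative on `[0,T)`, in a sense that includes the
initial value, is the primitive of its weak derivative. -/
theorem eq_add_integral_of_weak_derivative {F g : ℝ → ℝ} {F₀ T : ℝ} (hT : 0 < T)
    (hF : Continuous F) (hg : Integrable g)
    (h : ∀ χ : ℝ → ℝ, ContDiff ℝ ∞ χ → ∀ a c, c < T → tsupport χ ⊆ Icc a c →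
      (∫ r in 0..T, (deriv χ r * F r + χ r * g r)) + χ 0 * F₀ = 0) {t : ℝ} (ht : t ∈ Icc 0 T) :
    F t = F₀ + ∫ r in 0..t, g r := by
  -- A cutoff that ends at `t + ε < T` needs `t < T`; the endpoint follows by continuity.
  suffices hIco : ∀ t ∈ Ico 0 T, F t = F₀ + ∫ r in 0..t, g r by
    have hcl : IsClosed {t | F t = F₀ + ∫ r in 0..t, g r} :=
      isClosed_eq hF (continuous_const.add (continuous_primitive_of_integrable hg 0))
    have := closure_minimal hIco hcl
    rw [closure_Ico hT.ne] at this
    exact this ht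
  clear ht t
  intro t ht
  rw [← sub_eq_zero, ← abs_eq_zero]
  refine le_antisymm (le_of_forall_pos_le_add fun κ hκ => ?_) (abs_nonneg _)
  rw [zero_add]
  have hκ2 : 0 < κ / 2 := half_pos hκ
  obtain ⟨ε₁, hε₁, h₁⟩ := Metric.continuous_iff.1 hF t (κ / 2) hκ2
  obtain ⟨ε₂, hε₂, h₂⟩ := Metric.continuous_iff.1
    (continuous_primitive_of_integrable hg.norm t) t (κ / 2) hκ2
  set ε := min (min ε₁ ε₂ / 2) ((T - t) / 2) with hε
  have hTt : 0 < T - t := sub_pos.2 ht.2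
  have hε0 : 0 < ε := by positivity
  have hεT : ε ≤ (T - t) / 2 := min_le_right _ _
  have hεm : ε < min ε₁ ε₂ :=
    lt_of_le_of_lt (min_le_left _ _) (half_lt_self (lt_min hε₁ hε₂))
  obtain ⟨χ, hχ, hχs, hχI, hχ1, hχ0, hχneg, hχzero⟩ := exists_time_cutoff (t := t) hε0
  have hχc : Continuous χ := hχ.continuous
  have hχ'c : Continuous (deriv χ) := hχ.continuous_deriv (by simp)
  have hχg : Integrable fun r => χ r * g r :=
    hg.bdd_mul (c := 1) hχc.aestronglyMeasurable (Eventually.of_forall fun r => by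
      rw [Real.norm_of_nonneg (hχI r).1]; exact (hχI r).2)
  have hi1 : IntervalIntegrable (fun r => deriv χ r * F r) volume 0 T :=
    (hχ'c.mul hF).intervalIntegrable 0 T
  have hi2 : IntervalIntegrable (fun r => deriv χ r * F t) volume 0 T :=
    (hχ'c.mul continuous_const).intervalIntegrable 0 T
  have hw := h χ hχ _ (t + ε) (by linarith) hχs
  rw [intervalIntegral.integral_add hi1
    hχg.intervalIntegrable, hχ1 0 ⟨le_rfl, ht.1⟩, one_mul] at hw
  have hd : ∫ r in 0..T, deriv χ r = -1 := by
    rw [intervalIntegral.integral_deriv_eq_sub (fun r _ => hχ.differentiable (by simp) r)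
      (hχ'c.intervalIntegrable 0 T), hχ0 T (by linarith), hχ1 0 ⟨le_rfl, ht.1⟩, zero_sub]
  -- On `[0,T]`, `-deriv χ` is a probability density carried by `[t, t + ε]`, so `-∫ χ' F` is an
  -- average of values of `F` near `F t`.
  have hA : |F t + ∫ r in 0..T, deriv χ r * F r| ≤ κ / 2 := by
    have h3 : F t + ∫ r in 0..T, deriv χ r * F r = ∫ r in 0..T, deriv χ r * (F r - F t) := by
      simp_rw [mul_sub]
      rw [intervalIntegral.integral_sub hi1 hi2,
        intervalIntegral.integral_mul_const, hd]
      ring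
    rw [h3]
    have h4 : ∫ r in 0..T, -deriv χ r * (κ / 2) = κ / 2 := by
      rw [intervalIntegral.integral_mul_const, intervalIntegral.integral_neg, hd]
      ring
    rw [← h4, ← Real.norm_eq_abs]
    refine intervalIntegral.norm_integral_le_of_norm_le hT.le (Eventually.of_forall fun r hr => ?_)
      ((hχ'c.neg.mul continuous_const).intervalIntegrable 0 T)
    rw [norm_mul, Real.norm_of_nonpos (hχneg r hr.1.le)]
    by_cases hrI : r ∈ Icc t (t + ε)
    · refine mul_le_mul_of_nonneg_left ?_ (neg_nonneg.2 (hχneg r hr.1.le))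
      have := h₁ r (by
        rw [Real.dist_eq, abs_of_nonneg (sub_nonneg.2 hrI.1)]
        have := min_le_left ε₁ ε₂
        linarith [hrI.2])
      exact this.le
    · rw [hχzero r hr.1.le hrI]
      simp
  -- On `[0,T]`, `χ` differs from the indicator of `[0,t]` only on `[t, t + ε]`, where the integral
  -- of `‖g‖` is small.
  have hB : |(∫ r in 0..T, χ r * g r) - ∫ r in 0..t, g r| ≤ κ / 2 := by
    have h5 : ∫ r in 0..t, χ r * g r = ∫ r in 0..t, g r :=
      intervalIntegral.integral_congr fun r hr => by
        rw [uIcc_of_le ht.1] at hr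
        simp only [hχ1 r hr, one_mul]
    have h6 : ∫ r in (t + ε)..T, χ r * g r = 0 := by
      rw [intervalIntegral.integral_congr (g := fun _ => 0), intervalIntegral.integral_zero]
      intro r hr
      rw [uIcc_of_le (by linarith)] at hr
      simp only [hχ0 r hr.1, zero_mul]
    rw [← intervalIntegral.integral_add_adjacent_intervals (b := t) hχg.intervalIntegrable
      hχg.intervalIntegrable, ← intervalIntegral.integral_add_adjacent_intervals (b := t + ε)
      (a := t) hχg.intervalIntegrable hχg.intervalIntegrable, h5, h6, add_zero, add_sub_cancel_left]
    have h7 : |∫ r in t..(t + ε), χ r * g r| ≤ ∫ r in t..(t + ε), ‖g r‖ := by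
      rw [← Real.norm_eq_abs]
      refine intervalIntegral.norm_integral_le_of_norm_le (by linarith)
        (Eventually.of_forall fun r _ => ?_) hg.norm.intervalIntegrable
      rw [norm_mul, Real.norm_of_nonneg (hχI r).1]
      exact mul_le_of_le_one_left (norm_nonneg _) (hχI r).2
    refine h7.trans ((le_abs_self _).trans ?_)
    have h8 := h₂ (t + ε) (by
      rw [Real.dist_eq, add_sub_cancel_left, abs_of_pos hε0]
      exact hεm.trans_le (min_le_right _ _))
    rw [intervalIntegral.integral_same, Real.dist_eq, sub_zero] at h8
    exact h8.le
  have hfin : F t - (F₀ + ∫ r in 0..t, g r)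
      = (F t + ∫ r in 0..T, deriv χ r * F r) + ((∫ r in 0..T, χ r * g r) - ∫ r in 0..t, g r) := by
    linarith
  rw [hfin]
  exact (abs_add_le _ _).trans (by linarith)

/-! ### Bounded pairings of densities with functions and fields. -/

section Pairing

variable {n : ℕ} {Ω : Set (E n)} {α : ℝ≥0} {T : ℝ} {V : Type*} [NormedAddCommGroup V]
  [NormedSpace ℝ V] {ι : V →ₗ[ℝ] (E n → E n)} {C : ℝ} {v : ℝ → V}

theorem exists_integral_norm_le (hΩb : Bornology.IsBounded Ω) :
    ∃ c : ℝ, 0 ≤ c ∧ ∀ g : L2 Ω, ∫ x in Ω, ‖g x‖ ≤ c * ‖g‖ := by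
  refine ⟨((volume.restrict Ω) univ ^ (1 / (1 : ℝ≥0∞).toReal - 1 / (2 : ℝ≥0∞).toReal)).toReal,
    ENNReal.toReal_nonneg, fun g => ?_⟩
  have h := eLpNorm_le_eLpNorm_mul_rpow_measure_univ (p := 1) (q := 2) (by norm_num)
    (Lp.memLp g).1
  rw [integral_norm_eq_lintegral_enorm (Lp.memLp g).1, ← eLpNorm_one_eq_lintegral_enorm,
    Lp.norm_def, ← ENNReal.toReal_mul, mul_comm]
  refine ENNReal.toReal_mono (ENNReal.mul_ne_top (Lp.memLp g).2.ne
    (ENNReal.rpow_ne_top_of_nonneg (by norm_num) ?_)) h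
  simpa using hΩb.measure_lt_top.ne

theorem norm_setIntegral_mul_le (hΩ : IsOpen Ω) (hΩb : Bornology.IsBounded Ω) {c : ℝ}
    (hc : ∀ g : L2 Ω, ∫ x in Ω, ‖g x‖ ≤ c * ‖g‖) (g : L2 Ω) {h : E n → ℝ} {M : ℝ} (hM0 : 0 ≤ M)
    (hM : ∀ x ∈ Ω, ‖h x‖ ≤ M) : ‖∫ x in Ω, g x * h x‖ ≤ c * ‖g‖ * M := by
  refine (norm_integral_le_of_norm_le ((integrable_coeFn hΩb g).norm.mul_const M) ?_).trans ?_
  · filter_upwards [ae_restrict_mem hΩ.measurableSet] with x hx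
    rw [norm_mul]
    exact mul_le_mul_of_nonneg_left (hM x hx) (norm_nonneg _)
  · rw [integral_mul_const]
    exact mul_le_mul_of_nonneg_right (hc g) hM0

theorem exists_bound_of_isBounded {G : Type*} [SeminormedAddCommGroup G]
    (hΩb : Bornology.IsBounded Ω) {h : E n → G}
    (hh : Continuous h) : ∃ M : ℝ, 0 ≤ M ∧ ∀ x ∈ Ω, ‖h x‖ ≤ M := by
  obtain ⟨M, hM⟩ := hΩb.isCompact_closure.exists_bound_of_continuousOn hh.continuousOn
  exact ⟨|M|, abs_nonneg _, fun x hx => (hM x (subset_closure hx)).trans (le_abs_self _)⟩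

theorem integrable_coeFn_mul (hΩ : IsOpen Ω) (hΩb : Bornology.IsBounded Ω) (g : L2 Ω)
    {h : E n → ℝ} (hh : Continuous h) :
    Integrable (fun x => g x * h x) (volume.restrict Ω) := by
  obtain ⟨M, -, hM⟩ := exists_bound_of_isBounded hΩb hh
  refine (integrable_coeFn hΩb g).mul_bdd (c := M) hh.aestronglyMeasurable ?_
  filter_upwards [ae_restrict_mem hΩ.measurableSet] with x hx using hM x hx

theorem setIntegral_add_mul (hΩ : IsOpen Ω) (hΩb : Bornology.IsBounded Ω) (g g' : L2 Ω)
    {h : E n → ℝ} (hh : Continuous h) :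
    ∫ x in Ω, (g + g') x * h x = (∫ x in Ω, g x * h x) + ∫ x in Ω, g' x * h x := by
  rw [← integral_add (integrable_coeFn_mul hΩ hΩb g hh) (integrable_coeFn_mul hΩ hΩb g' hh)]
  refine integral_congr_ae ?_
  filter_upwards [Lp.coeFn_add g g'] with x hx
  rw [hx, Pi.add_apply, add_mul]

theorem setIntegral_smul_mul (a : ℝ) (g : L2 Ω) (h : E n → ℝ) :
    ∫ x in Ω, (a • g) x * h x = a * ∫ x in Ω, g x * h x := by
  rw [← integral_const_mul]
  refine integral_congr_ae ?_
  filter_upwards [Lp.coeFn_smul a g] with x hx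
  rw [hx, Pi.smul_apply, smul_eq_mul, mul_assoc]

theorem exists_pairing (hΩ : IsOpen Ω) (hΩb : Bornology.IsBounded Ω) {φ : E n → ℝ}
    (hφ : Continuous φ) : ∃ P : L2 Ω →L[ℝ] ℝ, ∀ g : L2 Ω, P g = ∫ x in Ω, g x * φ x := by
  obtain ⟨M, hM0, hM⟩ := exists_bound_of_isBounded hΩb hφ
  obtain ⟨c, -, hc⟩ := exists_integral_norm_le hΩb
  refine ⟨LinearMap.mkContinuous (σ := RingHom.id ℝ)
    { toFun := fun g : L2 Ω => ∫ x in Ω, g x * φ x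
      map_add' := fun g g' => setIntegral_add_mul hΩ hΩb g g' hφ
      map_smul' := fun a g => setIntegral_smul_mul a g φ } (c * M) fun g => ?_, fun g => rfl⟩
  exact (norm_setIntegral_mul_le hΩ hΩb hc g hM0 hM).trans_eq (by ring)

/-- As a bounded bilinear form, the pairing makes `t ↦ Q (f t) (v t)` measurable and lets Bochner
integrals of `v` pass through it. -/
theorem IsHolderFamily.exists_pairing (hι : IsHolderFamily Ω α C ι) (hΩ : IsOpen Ω)
    (hΩb : Bornology.IsBounded Ω) {A : E n → E n →L[ℝ] ℝ} (hA : Continuous A) :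
    ∃ Q : L2 Ω →L[ℝ] V →L[ℝ] ℝ, ∀ (g : L2 Ω) (w : V), Q g w = ∫ x in Ω, g x * A x (ι w x) := by
  obtain ⟨M, hM0, hM⟩ := exists_bound_of_isBounded hΩb hA
  obtain ⟨c, -, hc⟩ := exists_integral_norm_le hΩb
  have hcont : ∀ w, Continuous fun x => A x (ι w x) := fun w =>
    hA.clm_apply (hι.contDiff w).continuous
  refine ⟨LinearMap.mkContinuous₂ (LinearMap.mk₂ ℝ
    (fun (g : L2 Ω) (w : V) => ∫ x in Ω, g x * A x (ι w x))
    (fun g g' w => setIntegral_add_mul hΩ hΩb g g' (hcont w))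
    (fun a g w => setIntegral_smul_mul a g _) (fun g w w' => ?_) (fun a g w => ?_))
    (c * (M * C)) fun g w => ?_, fun g w => rfl⟩
  · rw [← integral_add (integrable_coeFn_mul hΩ hΩb g (hcont w))
      (integrable_coeFn_mul hΩ hΩb g (hcont w'))]
    simp only [map_add, Pi.add_apply, mul_add]
  · rw [smul_eq_mul, ← integral_const_mul]
    simp only [map_smul, Pi.smul_apply, smul_eq_mul]
    congr 1; ext x; ring
  · refine (norm_setIntegral_mul_le hΩ hΩb hc g (M := M * (C * ‖w‖))
      (mul_nonneg hM0 (mul_nonneg hι.nonneg (norm_nonneg _))) fun x hx => ?_).trans_eq (by ring)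
    exact (ContinuousLinearMap.le_opNorm _ _).trans
      (mul_le_mul (hM x hx) (hι.norm_le w x) (norm_nonneg _) hM0)

theorem integrable_pairing (hT : 0 ≤ T) (Q : L2 Ω →L[ℝ] V →L[ℝ] ℝ)
    (f : C(Icc (0 : ℝ) T, L2 Ω)) (hv : Integrable v) :
    Integrable fun t => Q (f (projIcc 0 T hT t)) (v t) := by
  refine (hv.norm.const_mul (‖Q‖ * ‖f‖)).mono' ?_ (Eventually.of_forall fun t => ?_)
  · exact Q.aestronglyMeasurable_comp₂
      (f.continuous.comp continuous_projIcc).aestronglyMeasurable hv.1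
  · refine (Q.le_opNorm₂ _ _).trans ?_
    gcongr
    exact f.norm_coe_le_norm _

end Pairing

/-! ### The integrated equation for time-independent test functions. -/

section WeakDerivative

variable {n : ℕ} {Ω : Set (E n)} {α : ℝ≥0} {T : ℝ} {V : Type*} [NormedAddCommGroup V]
  [NormedSpace ℝ V] {ι : V →ₗ[ℝ] (E n → E n)} {C : ℝ} {v : ℝ → V} {f₀ : L2 Ω}
  {f : C(Icc (0 : ℝ) T, L2 Ω)}

/-- Testing with products `χ(t) φ(x)` says that `t ↦ ∫ f(t) φ` has the inner integral as weak
derivative and `∫ f₀ φ` as initial value. -/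
theorem IsWeakSolution.setIntegral_mul_eq_of_isTestFunction (hι : IsHolderFamily Ω α C ι)
    (hv : Integrable v) (hΩ : IsOpen Ω) (hΩb : Bornology.IsBounded Ω) (hT : 0 < T)
    (hf : IsWeakSolution T Ω (fun t => ι (v t)) f₀ f) {φ : E n → ℝ} (hφ : IsTestFunction Ω φ)
    {t : ℝ} (ht : t ∈ Icc 0 T) :
    ∫ x in Ω, f (projIcc 0 T hT.le t) x * φ x = (∫ x in Ω, f₀ x * φ x)
      + ∫ r in 0..t, ∫ x in Ω, f (projIcc 0 T hT.le r) x * fderiv ℝ φ x (ι (v r) x) := by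
  obtain ⟨P, hP⟩ := exists_pairing hΩ hΩb hφ.1.continuous
  obtain ⟨Q, hQ⟩ := hι.exists_pairing hΩ hΩb hφ.continuous_fderiv
  have hcont : ∀ w, Continuous fun x => fderiv ℝ φ x (ι w x) := fun w =>
    hφ.continuous_fderiv.clm_apply (hι.contDiff w).continuous
  refine eq_add_integral_of_weak_derivative hT
    (F := fun t => ∫ x in Ω, f (projIcc 0 T hT.le t) x * φ x)
    (g := fun r => ∫ x in Ω, f (projIcc 0 T hT.le r) x * fderiv ℝ φ x (ι (v r) x)) ?_ ?_ ?_ ht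
  · simp_rw [← hP]
    exact P.continuous.comp (f.continuous.comp continuous_projIcc)
  · simp_rw [← hQ]
    exact integrable_pairing hT.le Q f hv
  · intro χ hχ a c hc hχs
    have h := (isWeakSolution_iff hT.le).1 hf _ (isTestFunction_mul hχ hχs hc hφ)
    refine Eq.trans ?_ h
    rw [intervalIntegral.integral_of_le hT.le, integral_Icc_eq_integral_Ioc]
    congr 1
    · refine integral_congr_ae (Eventually.of_forall fun r => ?_)
      simp only [fderiv_mul_apply_one hχ hφ, ← integral_const_mul]
      rw [← integral_add ((integrable_coeFn_mul hΩ hΩb _ hφ.1.continuous).const_mul _)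
        ((integrable_coeFn_mul hΩ hΩb _ (hcont _)).const_mul _)]
      refine integral_congr_ae (Eventually.of_forall fun x => ?_)
      ring
    · rw [← integral_const_mul]
      refine integral_congr_ae (Eventually.of_forall fun x => ?_)
      simp only
      ring

/-- All terms are continuous in `φ` for the `C¹` norm, so mollification extends the identity. The
extension is needed because test functions composed with the flow are only known to be `C¹`. -/
theorem IsWeakSolution.setIntegral_mul_eq (hι : IsHolderFamily Ω α C ι)
    (hv : Integrable v) (hΩ : IsOpen Ω) (hΩb : Bornology.IsBounded Ω) (hT : 0 < T)
    (hf : IsWeakSolution T Ω (fun t => ι (v t)) f₀ f) {φ : E n → ℝ} (hφ : IsC1TestFunction Ω φ)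
    {t : ℝ} (ht : t ∈ Icc 0 T) :
    ∫ x in Ω, f (projIcc 0 T hT.le t) x * φ x = (∫ x in Ω, f₀ x * φ x)
      + ∫ r in 0..t, ∫ x in Ω, f (projIcc 0 T hT.le r) x * fderiv ℝ φ x (ι (v r) x) := by
  obtain ⟨c, hc0, hc⟩ := exists_integral_norm_le hΩb
  have hdiff : ∀ (g : L2 Ω) {h k : E n → ℝ}, Continuous h → Continuous k → ∀ {ε : ℝ}, 0 ≤ ε →
      (∀ x, ‖h x - k x‖ ≤ ε) →
      |(∫ x in Ω, g x * h x) - ∫ x in Ω, g x * k x| ≤ c * ‖g‖ * ε := by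
    intro g h k hh hk ε hε hhk
    rw [← integral_sub (integrable_coeFn_mul hΩ hΩb g hh) (integrable_coeFn_mul hΩ hΩb g hk)]
    simp_rw [← mul_sub]
    exact norm_setIntegral_mul_le hΩ hΩb hc g hε fun x _ => hhk x
  rw [← sub_eq_zero, ← abs_eq_zero]
  refine le_antisymm (le_of_forall_pos_le_add fun κ hκ => ?_) (abs_nonneg _)
  rw [zero_add]
  -- `D * ε` is the sum of the errors from the three terms when `φ` is changed by `ε` in `C¹`.
  set D : ℝ := c * ‖f‖ + c * ‖f₀‖ + c * ‖f‖ * ∫ r, C * ‖v r‖ with hD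
  have hI : 0 ≤ ∫ r, C * ‖v r‖ :=
    integral_nonneg fun r => mul_nonneg hι.nonneg (norm_nonneg _)
  have hD0 : 0 ≤ D := by positivity
  set ε := κ / (D + 1) with hε
  have hε0 : 0 < ε := by positivity
  have hεD : D * ε ≤ κ := by
    rw [hε, mul_div_assoc', div_le_iff₀ (by positivity)]
    nlinarith
  obtain ⟨ψ, hψ, h1, h2⟩ := hφ.exists_isTestFunction_near hΩ hε0
  have heq := hf.setIntegral_mul_eq_of_isTestFunction hι hv hΩ hΩb hT hψ ht
  obtain ⟨Q, hQ⟩ := hι.exists_pairing hΩ hΩb hφ.continuous_fderiv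
  obtain ⟨Q', hQ'⟩ := hι.exists_pairing hΩ hΩb hψ.continuous_fderiv
  have hfn : ∀ r, ‖f (projIcc 0 T hT.le r)‖ ≤ ‖f‖ := fun r => f.norm_coe_le_norm _
  have e1 := hdiff (f (projIcc 0 T hT.le t)) hψ.1.continuous hφ.contDiff.continuous hε0.le h1
  have e2 := hdiff f₀ hψ.1.continuous hφ.contDiff.continuous hε0.le h1
  have e3 : |(∫ r in 0..t, ∫ x in Ω, f (projIcc 0 T hT.le r) x * fderiv ℝ ψ x (ι (v r) x))
      - ∫ r in 0..t, ∫ x in Ω, f (projIcc 0 T hT.le r) x * fderiv ℝ φ x (ι (v r) x)|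
      ≤ c * ‖f‖ * ε * ∫ r, C * ‖v r‖ := by
    rw [← intervalIntegral.integral_sub, ← integral_const_mul]
    · rw [← Real.norm_eq_abs]
      refine norm_intervalIntegral_le_integral ((hv.norm.const_mul C).const_mul _) (fun r => ?_) 0 t
      refine (hdiff _ (hψ.continuous_fderiv.clm_apply (hι.contDiff _).continuous)
        (hφ.continuous_fderiv.clm_apply (hι.contDiff _).continuous) (ε := ε * (C * ‖v r‖))
        (mul_nonneg hε0.le (mul_nonneg hι.nonneg (norm_nonneg _))) fun x => ?_).trans ?_
      · rw [← _root_.sub_apply]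
        exact (ContinuousLinearMap.le_opNorm _ _).trans
          (mul_le_mul (h2 x) (hι.norm_le _ _) (norm_nonneg _) hε0.le)
      · have := hι.nonneg
        rw [← mul_assoc]
        gcongr
        exact hfn r
    · simp_rw [← hQ']
      exact (integrable_pairing hT.le Q' f hv).intervalIntegrable
    · simp_rw [← hQ]
      exact (integrable_pairing hT.le Q f hv).intervalIntegrable
  have e1' : c * ‖f (projIcc 0 T hT.le t)‖ * ε ≤ c * ‖f‖ * ε := by
    gcongr
    exact hfn t
  rw [abs_le] at e1 e2 e3 ⊢
  have hDε : D * ε = c * ‖f‖ * ε + c * ‖f₀‖ * ε + c * ‖f‖ * ε * ∫ r, C * ‖v r‖ := by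
    rw [hD]; ring
  constructor <;> linarith [e1.1, e1.2, e2.1, e2.2, e3.1, e3.2]

end WeakDerivative

end ContinuityEquation

/-! ### Uniqueness by conservation along the flow. -/

namespace ContinuityEquation

open Filter Topology BoundedContinuousFunction

/-- A function whose increments are, on short intervals, arbitrarily small multiples of those of a
monotone function is constant. -/
theorem eq_of_small_increments {H M : ℝ → ℝ} {T : ℝ}
    (h : ∀ ε > 0, ∃ δ > 0, ∀ t₁ ∈ Icc 0 T, ∀ t₂ ∈ Icc 0 T, t₁ ≤ t₂ → t₂ - t₁ < δ →
      |H t₂ - H t₁| ≤ ε * (M t₂ - M t₁)) (hM : MonotoneOn M (Icc 0 T)) {t : ℝ}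
    (ht : t ∈ Icc 0 T) : H t = H 0 := by
  have key : ∀ ε > 0, |H t - H 0| ≤ ε * (M t - M 0) := by
    intro ε hε
    obtain ⟨δ, hδ, hδH⟩ := h ε hε
    -- Induction on the number of steps of length `δ / 2` needed to reach `t`; the bounds telescope.
    have hk : ∀ k : ℕ, ∀ t ∈ Icc 0 T, t ≤ k * (δ / 2) → |H t - H 0| ≤ ε * (M t - M 0) := by
      intro k
      induction k with
      | zero =>
        intro t ht htk
        have : t = 0 := le_antisymm (by simpa using htk) ht.1
        simp [this]
      | succ k ih =>
        intro t ht htk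
        push_cast at htk
        set s := max 0 (t - δ / 2) with hs
        have hst : s ≤ t := max_le ht.1 (by linarith)
        have hsm : s ∈ Icc 0 T := ⟨le_max_left _ _, hst.trans ht.2⟩
        have h1 := ih s hsm (max_le (by positivity) (by linarith))
        have h2 := hδH s hsm t ht hst (by linarith [le_max_right 0 (t - δ / 2)])
        have h3 := abs_sub_le (H t) (H s) (H 0)
        linarith
    obtain ⟨k, hk'⟩ := exists_nat_ge (t / (δ / 2))
    exact hk k t ht ((div_le_iff₀ (by positivity)).1 hk')
  rw [← sub_eq_zero, ← abs_eq_zero]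
  refine le_antisymm (le_of_forall_pos_le_add fun κ hκ => ?_) (abs_nonneg _)
  have hM0 : 0 ≤ M t - M 0 := sub_nonneg.2 (hM (left_mem_Icc.2 (ht.1.trans ht.2)) ht ht.1)
  have := key (κ / (M t - M 0 + 1)) (by positivity)
  refine this.trans ?_
  rw [zero_add, div_mul_eq_mul_div, div_le_iff₀ (by positivity)]
  nlinarith

section Uniqueness

variable {n : ℕ} {Ω : Set (E n)} {α : ℝ≥0} {T : ℝ} {V : Type*} [NormedAddCommGroup V]
  [NormedSpace ℝ V] {ι : V →ₗ[ℝ] (E n → E n)} {C : ℝ} {v : ℝ → V} {f₀ : L2 Ω}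
  {f : C(Icc (0 : ℝ) T, L2 Ω)}

theorem IsC1TestFunction.comp_flow {m : ℝ → ℝ} {b : ℝ → E n → E n} (hb : IsHolderField α m b)
    (hα : 0 < α) (h0 : ∀ t, ∀ x ∉ Ω, b t x = 0) {ψ : E n → ℝ} (hψ : IsC1TestFunction Ω ψ)
    (t s : ℝ) : IsC1TestFunction Ω fun x => ψ (hb.flow hα t s x) := by
  have hsub : tsupport (fun x => ψ (hb.flow hα t s x)) ⊆ hb.flow hα t s ⁻¹' tsupport ψ :=
    closure_minimal (fun x hx => subset_tsupport ψ hx)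
      ((isClosed_tsupport ψ).preimage (hb.contDiff_flow hα t s).continuous)
  have himg : hb.flow hα t s ⁻¹' tsupport ψ ⊆ hb.flow hα s t '' tsupport ψ :=
    fun x hx => ⟨_, hx, hb.flow_flow_cancel hα t s x⟩
  refine ⟨hψ.contDiff.comp (hb.contDiff_flow hα t s), ?_, ?_⟩
  · exact (hψ.hasCompactSupport.isCompact.image
      (hb.contDiff_flow hα s t).continuous).of_isClosed_subset (isClosed_tsupport _)
      (hsub.trans himg)
  · refine (hsub.trans himg).trans ?_
    rintro _ ⟨y, hy, rfl⟩
    exact hb.flow_mem hα h0 s t (hψ.tsupport_subset hy)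

theorem IsC1TestFunction.continuous_fderiv_comp_flow {m : ℝ → ℝ} {b : ℝ → E n → E n}
    (hb : IsHolderField α m b) (hα : 0 < α) {ψ : E n → ℝ} (hψ : IsC1TestFunction Ω ψ) (s : ℝ) :
    Continuous fun p : ℝ × E n => fderiv ℝ (fun x => ψ (hb.flow hα s p.1 x)) p.2 := by
  have h : ∀ p : ℝ × E n, fderiv ℝ (fun x => ψ (hb.flow hα s p.1 x)) p.2
      = (fderiv ℝ ψ (hb.flow hα s p.1 p.2)).comp (fderiv ℝ (hb.flow hα s p.1) p.2) := fun p =>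
    ((hψ.contDiff.differentiable one_ne_zero _).hasFDerivAt.comp p.2
      (hb.hasFDerivAt_flow hα s p.1 p.2)).fderiv
  simp_rw [h]
  exact (hψ.continuous_fderiv.comp (hb.continuous_flow_initial hα s)).clm_comp
    (hb.continuous_fderiv_flow_initial hα s)

/-- Error of one Euler step: the trajectory stays within `∫ C‖v‖` of `x`, and freezing it at `x`
costs the Lipschitz constant `C‖v r‖` times that distance. Being quadratic, the error is negligible
on short intervals. -/
theorem IsHolderFamily.norm_flow_sub_sub_le [CompleteSpace V] (hι : IsHolderFamily Ω α C ι)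
    (hα : 0 < α) (hv : Integrable v) {t₁ t₂ : ℝ} (h : t₁ ≤ t₂) (x : E n) :
    ‖(hι.isHolderField hv).flow hα t₂ t₁ x - x - ι (∫ r in t₁..t₂, v r) x‖
      ≤ (∫ r in t₁..t₂, C * ‖v r‖) * ∫ r in t₁..t₂, C * ‖v r‖ := by
  set hb := hι.isHolderField hv
  have hev : ι (∫ r in t₁..t₂, v r) x = ∫ r in t₁..t₂, ι (v r) x :=
    ((LinearMap.mkContinuous (σ := RingHom.id ℝ)
      { toFun := fun w => ι w x
        map_add' := fun w w' => by rw [map_add, Pi.add_apply]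
        map_smul' := fun a w => by rw [map_smul, Pi.smul_apply]; rfl } C
      fun w => hι.norm_le w x).intervalIntegral_comp_comm hv.intervalIntegrable).symm
  have hfl := hb.flow_sub_flow hα t₂ t₁ t₁ x
  rw [hb.flow_self] at hfl
  rw [hfl, hev, ← intervalIntegral.integral_sub (hb.integrable_flow hα t₁ x).intervalIntegrable
    (hb.integrable_comp (γ := fun _ => x) continuous_const).intervalIntegrable,
    ← intervalIntegral.integral_mul_const]
  refine intervalIntegral.norm_integral_le_of_norm_le h (Eventually.of_forall fun r hr => ?_)
    (hb.integrable.mul_const _).intervalIntegrable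
  refine (hb.norm_sub_le r _ _).trans (mul_le_mul_of_nonneg_left ?_ (hb.nonneg r))
  refine (hb.norm_flow_sub_self_le hα r t₁ x).trans ?_
  rw [abs_of_nonneg (intervalIntegral.integral_nonneg hr.1.le fun u _ => hb.nonneg u)]
  exact intervalIntegral.integral_mono_interval le_rfl hr.1.le hr.2
    (Eventually.of_forall hb.nonneg) hb.integrable.intervalIntegrable

/-- Over a short interval with `w = ∫ v`, the change of `f` against the frozen `Φ t₂` is about `∫
f(t₁) DΦ_{t₂} w`. Since `Φ` is constant along trajectories, which move `x` to about `x + w(x)`, the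
change of `Φ` contributes about the opposite. Both errors are small multiples of `∫ m`. -/
theorem IsWeakSolution.setIntegral_mul_comp_flow [CompleteSpace V] (hι : IsHolderFamily Ω α C ι)
    (hα : 0 < α) (hv : Integrable v) (hΩ : IsOpen Ω) (hΩb : Bornology.IsBounded Ω) (hT : 0 < T)
    (hf : IsWeakSolution T Ω (fun t => ι (v t)) f₀ f) {ψ : E n → ℝ} (hψ : IsC1TestFunction Ω ψ)
    {t : ℝ} (ht : t ∈ Icc 0 T) :
    ∫ x in Ω, f (projIcc 0 T hT.le t) x * ψ ((hι.isHolderField hv).flow hα 0 t x)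
      = ∫ x in Ω, f₀ x * ψ x := by
  set hb := hι.isHolderField hv with hbdef
  have h0 : ∀ t, ∀ x ∉ Ω, ι (v t) x = 0 := fun t => hι.eq_zero _
  set Φ : ℝ → E n → ℝ := fun t x => ψ (hb.flow hα 0 t x) with hΦdef
  have hΦ : ∀ t, IsC1TestFunction Ω (Φ t) := fun t => hψ.comp_flow hb hα h0 0 t
  have hDΦ : Continuous fun p : ℝ × E n => fderiv ℝ (Φ p.1) p.2 :=
    hψ.continuous_fderiv_comp_flow hb hα 0
  obtain ⟨R, hR⟩ := hΩb.subset_closedBall 0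
  have hS : IsCompact (Icc 0 T ×ˢ Metric.closedBall (0 : E n) R) :=
    isCompact_Icc.prod (isCompact_closedBall _ _)
  obtain ⟨K, hK0, hK⟩ : ∃ K : ℝ, 0 ≤ K ∧ ∀ t ∈ Icc 0 T, ∀ x ∈ Ω, ‖fderiv ℝ (Φ t) x‖ ≤ K := by
    obtain ⟨K, hK⟩ := hS.exists_bound_of_continuousOn hDΦ.continuousOn
    exact ⟨|K|, abs_nonneg _, fun t ht x hx => (hK (t, x) ⟨ht, hR hx⟩).trans (le_abs_self _)⟩
  obtain ⟨c, hc0, hc⟩ := exists_integral_norm_le hΩb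
  set fe : ℝ → L2 Ω := fun r => f (projIcc 0 T hT.le r) with hfe
  have hfec : Continuous fe := f.continuous.comp continuous_projIcc
  have hfn : ∀ r, ‖fe r‖ ≤ ‖f‖ := fun r => f.norm_coe_le_norm _
  set m : ℝ → ℝ := fun r => C * ‖v r‖ with hm
  have hmint : Integrable m := hv.norm.const_mul C
  have hm0 : ∀ r, 0 ≤ m r := hb.nonneg
  set M : ℝ → ℝ := fun t => ∫ r in 0..t, m r with hMdef
  have hMsub : ∀ t₁ t₂, M t₂ - M t₁ = ∫ r in t₁..t₂, m r := fun t₁ t₂ =>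
    intervalIntegral.integral_interval_sub_left hmint.intervalIntegrable hmint.intervalIntegrable
  suffices hconst : ∫ x in Ω, fe t x * Φ t x = ∫ x in Ω, fe 0 x * Φ 0 x by
    have h00 := hf.setIntegral_mul_eq hι hv hΩ hΩb hT hψ (left_mem_Icc.2 hT.le)
    rw [intervalIntegral.integral_same, add_zero] at h00
    rw [← h00]
    refine hconst.trans ?_
    simp only [hΦdef, IsHolderField.flow_self, hfe]
  refine eq_of_small_increments (H := fun t => ∫ x in Ω, fe t x * Φ t x) (M := M) ?_ ?_ ht
  swap
  · intro t₁ _ t₂ _ h12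
    rw [← sub_nonneg, hMsub]
    exact intervalIntegral.integral_nonneg h12 fun u _ => hm0 u
  intro ε hε
  -- `L` is the sum of the constants in `e4` and `e3`.
  set L := c * ‖f‖ * (K + 1) + c * K with hL
  have hL0 : 0 ≤ L := by positivity
  set ε' := ε / (L + 1) with hε'
  have hε'0 : 0 < ε' := by positivity
  have hLε : L * ε' ≤ ε := by
    rw [hε', mul_div_assoc', div_le_iff₀ (by positivity)]
    nlinarith
  obtain ⟨δu, hδu, hu⟩ := Metric.uniformContinuousOn_iff.1
    (hS.uniformContinuousOn_of_continuous hDΦ.continuousOn) ε' hε'0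
  -- Short intervals make `μ < ε'`, which absorbs the quadratic Euler error, and `μ < δu`, which
  -- keeps trajectories within the range of uniform continuity of `DΦ`.
  obtain ⟨δ₁, hδ₁, hd₁⟩ := Metric.uniformContinuousOn_iff.1
    (isCompact_Icc.uniformContinuousOn_of_continuous (s := Icc 0 T)
      (continuous_primitive_of_integrable hmint 0).continuousOn) (min ε' δu) (lt_min hε'0 hδu)
  obtain ⟨δ₂, hδ₂, hd₂⟩ := Metric.uniformContinuousOn_iff.1
    (isCompact_Icc.uniformContinuousOn_of_continuous (s := Icc 0 T) hfec.continuousOn) ε' hε'0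
  refine ⟨min δ₁ δ₂, lt_min hδ₁ hδ₂, fun t₁ ht₁ t₂ ht₂ h12 hδ => ?_⟩
  set μ := ∫ r in t₁..t₂, m r with hμ
  have hμ0 : 0 ≤ μ := intervalIntegral.integral_nonneg h12 fun u _ => hm0 u
  have hμlt : μ < min ε' δu := by
    have : |M t₂ - M t₁| < min ε' δu := hd₁ t₂ ht₂ t₁ ht₁ (by
      rw [Real.dist_eq, abs_of_nonneg (sub_nonneg.2 h12)]
      exact hδ.trans_le (min_le_left _ _))
    rw [hMsub] at this
    exact (le_abs_self _).trans_lt this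
  have hμε : μ ≤ ε' := (hμlt.trans_le (min_le_left _ _)).le
  obtain ⟨Q, hQ⟩ := hι.exists_pairing hΩ hΩb (hΦ t₂).continuous_fderiv
  set w := ∫ r in t₁..t₂, v r with hw
  have hQint := integrable_pairing hT.le Q f hv
  have hQint1 : Integrable fun r => Q (fe t₁) (v r) := (Q (fe t₁)).integrable_comp hv
  have e1 : (∫ x in Ω, fe t₂ x * Φ t₂ x) - ∫ x in Ω, fe t₁ x * Φ t₂ x
      = ∫ r in t₁..t₂, Q (fe r) (v r) := by
    rw [hf.setIntegral_mul_eq hι hv hΩ hΩb hT (hΦ t₂) ht₂,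
      hf.setIntegral_mul_eq hι hv hΩ hΩb hT (hΦ t₂) ht₁, add_sub_add_left_eq_sub]
    simp_rw [← hQ]
    exact intervalIntegral.integral_interval_sub_left hQint.intervalIntegrable
      hQint.intervalIntegrable
  have e2 : ∫ r in t₁..t₂, Q (fe t₁) (v r) = Q (fe t₁) w :=
    (Q (fe t₁)).intervalIntegral_comp_comm hv.intervalIntegrable
  have e3 : |(∫ r in t₁..t₂, Q (fe r) (v r)) - Q (fe t₁) w| ≤ c * K * ε' * μ := by
    rw [← e2, ← intervalIntegral.integral_sub hQint.intervalIntegrable hQint1.intervalIntegrable,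
      hμ, ← intervalIntegral.integral_const_mul, ← Real.norm_eq_abs]
    refine intervalIntegral.norm_integral_le_of_norm_le h12 (Eventually.of_forall fun r hr => ?_)
      (hmint.const_mul _).intervalIntegrable
    have hrI : r ∈ Icc 0 T := ⟨ht₁.1.trans hr.1.le, hr.2.trans ht₂.2⟩
    have h1 : Q (fe r) (v r) - Q (fe t₁) (v r) = Q (fe r - fe t₁) (v r) := by
      rw [map_sub, _root_.sub_apply]
    have h2 : ‖fe r - fe t₁‖ ≤ ε' := by
      rw [← dist_eq_norm]
      refine (hd₂ r hrI t₁ ht₁ ?_).le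
      rw [Real.dist_eq, abs_of_nonneg (sub_nonneg.2 hr.1.le)]
      exact (sub_le_sub_right hr.2 _).trans_lt (hδ.trans_le (min_le_right _ _))
    rw [h1, hQ]
    refine (norm_setIntegral_mul_le hΩ hΩb hc _ (M := K * m r) (mul_nonneg hK0 (hm0 r))
      fun x hx => ?_).trans ?_
    · exact (ContinuousLinearMap.le_opNorm _ _).trans
        (mul_le_mul (hK t₂ ht₂ x hx) (hι.norm_le _ _) (norm_nonneg _) hK0)
    · have := mul_le_mul_of_nonneg_left h2 hc0
      have h3 := mul_le_mul_of_nonneg_right this (mul_nonneg hK0 (hm0 r))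
      linarith
  have hcw : Continuous fun x => fderiv ℝ (Φ t₂) x (ι w x) :=
    (hΦ t₂).continuous_fderiv.clm_apply (hι.contDiff w).continuous
  have e4 : |Q (fe t₁) w + ((∫ x in Ω, fe t₁ x * Φ t₂ x) - ∫ x in Ω, fe t₁ x * Φ t₁ x)|
      ≤ c * ‖f‖ * (K + 1) * ε' * μ := by
    have hi₁ := integrable_coeFn_mul hΩ hΩb (fe t₁) (hΦ t₁).contDiff.continuous
    have hi₂ := integrable_coeFn_mul hΩ hΩb (fe t₁) (hΦ t₂).contDiff.continuous
    have hi : Integrable (fun x => fe t₁ x * Φ t₂ x - fe t₁ x * Φ t₁ x) (volume.restrict Ω) :=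
      hi₂.sub hi₁
    rw [hQ, ← integral_sub hi₂ hi₁, ← integral_add (integrable_coeFn_mul hΩ hΩb _ hcw) hi]
    simp_rw [← mul_sub, ← mul_add]
    refine (norm_setIntegral_mul_le hΩ hΩb hc (fe t₁) (M := (K + 1) * ε' * μ)
      (by positivity) fun x hx => ?_).trans ?_
    · set X := hb.flow hα t₂ t₁ x with hX
      have hXΩ : X ∈ Ω := hb.flow_mem hα h0 t₂ t₁ hx
      have hXx : ‖X - x‖ ≤ μ := by
        have := hb.norm_flow_sub_self_le hα t₂ t₁ x
        rwa [abs_of_nonneg hμ0] at this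
      have hΦX : Φ t₁ x = Φ t₂ X := by
        simp only [hΦdef, hX, IsHolderField.flow_flow]
      have hrem : ‖Φ t₂ X - Φ t₂ x - fderiv ℝ (Φ t₂) x (X - x)‖ ≤ ε' * ‖X - x‖ := by
        refine ((convex_closedBall (0 : E n) R).inter
          (convex_closedBall x ‖X - x‖)).norm_image_sub_le_of_norm_hasFDerivWithin_le'
          (f' := fderiv ℝ (Φ t₂)) (fun z _ => ?_) (fun z hz => ?_)
          ⟨hR hx, Metric.mem_closedBall_self (norm_nonneg _)⟩ ⟨hR hXΩ, by simp [dist_eq_norm]⟩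
        · exact ((hΦ t₂).contDiff.differentiable one_ne_zero z).hasFDerivAt.hasFDerivWithinAt
        · rw [← dist_eq_norm]
          refine (hu (t₂, z) ⟨ht₂, hz.1⟩ (t₂, x) ⟨ht₂, hR hx⟩ ?_).le
          rw [Prod.dist_eq, dist_self]
          refine max_lt hδu (lt_of_le_of_lt (Metric.mem_closedBall.1 hz.2) ?_)
          exact hXx.trans_lt (hμlt.trans_le (min_le_right _ _))
      have hlin : ‖fderiv ℝ (Φ t₂) x (X - x - ι w x)‖ ≤ K * (μ * μ) :=
        (ContinuousLinearMap.le_opNorm _ _).trans (mul_le_mul (hK t₂ ht₂ x hx)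
          (hι.norm_flow_sub_sub_le hα hv h12 x) (norm_nonneg _) hK0)
      have hsplit : fderiv ℝ (Φ t₂) x (ι w x) + (Φ t₂ x - Φ t₁ x)
          = -(Φ t₂ X - Φ t₂ x - fderiv ℝ (Φ t₂) x (X - x))
            - fderiv ℝ (Φ t₂) x (X - x - ι w x) := by
        rw [hΦX, map_sub _ (X - x)]
        ring
      rw [hsplit]
      refine (norm_sub_le _ _).trans ?_
      rw [norm_neg]
      have h5 : ε' * ‖X - x‖ ≤ ε' * μ := mul_le_mul_of_nonneg_left hXx hε'0.le
      have h6 : K * (μ * μ) ≤ K * (ε' * μ) := by gcongr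
      linarith
    · have := mul_le_mul_of_nonneg_left (hfn t₁) hc0
      have h3 := mul_le_mul_of_nonneg_right this
        (show 0 ≤ (K + 1) * ε' * μ by positivity)
      linarith
  have hsum : (∫ x in Ω, fe t₂ x * Φ t₂ x) - ∫ x in Ω, fe t₁ x * Φ t₁ x
      = ((∫ r in t₁..t₂, Q (fe r) (v r)) - Q (fe t₁) w)
        + (Q (fe t₁) w + ((∫ x in Ω, fe t₁ x * Φ t₂ x) - ∫ x in Ω, fe t₁ x * Φ t₁ x)) := by
    rw [← e1]; ring
  rw [hsum, hMsub]
  refine (abs_add_le _ _).trans ?_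
  have h7 : L * ε' * μ ≤ ε * μ := mul_le_mul_of_nonneg_right hLε hμ0
  have h8 : L * ε' * μ = c * ‖f‖ * (K + 1) * ε' * μ + c * K * ε' * μ := by rw [hL]; ring
  linarith

/-- Conservation applied to `ψ = φ(X(t,0,·))` has `ψ(X(0,t,·)) = φ`, so `∫ f(t) φ = ∫ f₀
φ(X(t,0,·))`. By duality the transported density has the same integrals against every test function.
-/
theorem IsWeakSolution.eq_transportL2 [CompleteSpace V] (hι : IsHolderFamily Ω α C ι)
    (hα : 0 < α) (hv : Integrable v) (hΩ : IsOpen Ω) (hΩb : Bornology.IsBounded Ω) (hT : 0 < T)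
    (hf : IsWeakSolution T Ω (fun t => ι (v t)) f₀ f) :
    f = (hι.isHolderField hv).transportL2 hα hΩ hΩb (fun _ => hι.eq_zero _) T f₀ := by
  set hb := hι.isHolderField hv with hbdef
  have h0 : ∀ t, ∀ x ∉ Ω, ι (v t) x = 0 := fun t => hι.eq_zero _
  ext1 t
  set g := hb.transportL2 hα hΩ hΩb h0 T f₀ t with hg
  refine Lp.ext ?_
  have hint : Integrable (fun x => f t x - g x) (volume.restrict Ω) :=
    (integrable_coeFn hΩb _).sub (integrable_coeFn hΩb _)
  have h := hΩ.ae_eq_zero_of_integral_contDiff_smul_eq_zero (μ := volume)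
    (f := fun x => f t x - g x) (IntegrableOn.locallyIntegrableOn hint) fun φ hφ hφc hφs => ?_
  · filter_upwards [ae_restrict_of_ae h, ae_restrict_mem hΩ.measurableSet] with x hx hxΩ
    exact sub_eq_zero.1 (hx hxΩ)
  have hφt : IsTestFunction Ω φ := ⟨hφ, hφc, hφs⟩
  have hψ := hφt.isC1TestFunction.comp_flow hb hα h0 t 0
  have h1 := hf.setIntegral_mul_comp_flow hι hα hv hΩ hΩb hT hψ t.2
  simp only [IsHolderField.flow_flow_cancel, projIcc_val] at h1
  have h2 := hb.setIntegral_transportL2_mul hα hΩ hΩb h0 f₀ t φ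
  rw [← h2] at h1
  have hsupp : ∀ x, x ∉ Ω → φ x • (f t x - g x) = 0 := fun x hx => by
    rw [image_eq_zero_of_notMem_tsupport fun h => hx (hφs h), zero_smul]
  rw [← setIntegral_eq_integral_of_forall_compl_eq_zero hsupp]
  simp_rw [smul_eq_mul, mul_sub, mul_comm (φ _)]
  rw [integral_sub (integrable_coeFn_mul hΩ hΩb _ hφ.continuous)
    (integrable_coeFn_mul hΩ hΩb _ hφ.continuous), h1, sub_self]

end Uniqueness

end ContinuityEquation

/-! ### Assembly for the original field. -/

theorem mainTheorem4 {n : ℕ} {Ω : Set (ContinuityEquation.E n)}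
    (hΩ_open : IsOpen Ω) (hΩ_convex : Convex ℝ Ω) (hΩ_bounded : Bornology.IsBounded Ω)
    {T : ℝ} (hT : 0 < T) {α : ℝ≥0} (hα : 0 < α)
    {V : Type*} [NormedAddCommGroup V] [NormedSpace ℝ V] [CompleteSpace V]
    (ι : V →ₗ[ℝ] (ContinuityEquation.E n → ContinuityEquation.E n))
    (hι : ContinuityEquation.IsContinuousEmbedding Ω α ι)
    (v : ℝ → V) (hv : MemLp v 2 (volume.restrict (Icc 0 T)))
    (f₀ : ContinuityEquation.L2 Ω) :
    -- the characteristic ODE has a flow `X` of `C¹` self-maps of `Ω`, and only one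
    ∃ X : ℝ → ℝ → ContinuityEquation.E n → ContinuityEquation.E n,
      ContinuityEquation.IsFlow T Ω (fun t => ι (v t)) X ∧
      (∀ Y, ContinuityEquation.IsFlow T Ω (fun t => ι (v t)) Y →
        ∀ t ∈ Icc 0 T, ∀ s ∈ Icc 0 T, ∀ x ∈ Ω, Y t s x = X t s x) ∧
      (∀ t ∈ Icc 0 T, ∀ s ∈ Icc 0 T, MapsTo (X t s) Ω Ω ∧ ContDiffOn ℝ 1 (X t s) Ω) ∧
      -- the weak solution exists, is unique, and is given by the formula
      (∃! f : C(Icc (0 : ℝ) T, ContinuityEquation.L2 Ω),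
        ContinuityEquation.IsWeakSolution T Ω (fun t => ι (v t)) f₀ f) ∧
      ∀ f : C(Icc (0 : ℝ) T, ContinuityEquation.L2 Ω),
        ContinuityEquation.IsWeakSolution T Ω (fun t => ι (v t)) f₀ f →
        ∀ t : Icc (0 : ℝ) T, ∀ᵐ x ∂(volume.restrict Ω),
          f t x = (fderiv ℝ (X 0 t) x).det * f₀ (X 0 t x) := by
  obtain ⟨C, hC⟩ := hι.exists_isHolderFamily hΩ_open
  -- The cutoff makes the field integrable on `ℝ` and changes it only on a null set of `[0,T]`. The
  -- half-open interval matches `uIoc`, so the field vanishes on the whole integration range between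
  -- a time outside `[0,T]` and the nearest endpoint.
  set w : ℝ → V := (Ioc 0 T).indicator v with hw
  have hwi : Integrable w := by
    rw [hw, integrable_indicator_iff measurableSet_Ioc]
    exact IntegrableOn.mono_set (hv.integrable one_le_two) Ioc_subset_Icc_self
  set hb := hC.isHolderField hwi with hbdef
  have h0 : ∀ t, ∀ x ∉ Ω, ι (w t) x = 0 := fun t => hC.eq_zero _
  have h0' : ∀ t ∉ Ioc 0 T, ∀ x, ι (w t) x = 0 := fun t ht x => by
    rw [hw, indicator_of_notMem ht, map_zero, Pi.zero_apply]
  have hae : ∀ᵐ t ∂(volume.restrict (Icc 0 T)), ι (v t) = ι (w t) := by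
    rw [← Measure.restrict_congr_set Ioc_ae_eq_Icc]
    filter_upwards [ae_restrict_mem measurableSet_Ioc] with t ht
    rw [hw, indicator_of_mem ht]
  have hweak : ∀ f, ContinuityEquation.IsWeakSolution T Ω (fun t => ι (v t)) f₀ f ↔
      ContinuityEquation.IsWeakSolution T Ω (fun t => ι (w t)) f₀ f := fun f =>
    ContinuityEquation.isWeakSolution_congr hT.le hae
  refine ⟨fun t s x => hb.flow hα t s x, ⟨?_, ?_, ?_⟩, ?_, ?_, ?_, ?_⟩
  · exact fun s _ x _ => hb.absolutelyContinuousOnInterval_flow hα s x 0 T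
  · intro s _ x _
    filter_upwards [hae, ae_restrict_of_ae (hb.ae_hasDerivAt_flow hα s x)] with t h1 h2
    rwa [h1]
  · exact fun s _ x _ => hb.flow_self hα s x
  · intro Y hY t ht s hs x hx
    have hd : ∀ᵐ t, t ∈ Icc 0 T → HasDerivAt (fun τ => Y τ s x) (ι (w t) (Y t s x)) t := by
      rw [← ae_restrict_iff' measurableSet_Icc]
      filter_upwards [hae, hY.ode s hs x hx] with t h1 h2
      rwa [← h1]
    have := hb.eq_flow_of_absolutelyContinuous hα hT.le h0'
      (hY.absolutelyContinuous s hs x hx) hd hs ht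
    rwa [hY.initial s hs x hx] at this
  · exact fun t _ s _ => ⟨fun x hx => hb.flow_mem hα h0 t s hx, (hb.contDiff_flow hα t s).contDiffOn⟩
  · refine ⟨hb.transportL2 hα hΩ_open hΩ_bounded h0 T f₀, ?_, fun f hf => ?_⟩
    · exact (hweak _).2 (hC.isWeakSolution_transportL2 hα hwi hΩ_open hΩ_bounded hT.le f₀)
    · exact ((hweak f).1 hf).eq_transportL2 hC hα hwi hΩ_open hΩ_bounded hT
  · intro f hf t
    rw [((hweak f).1 hf).eq_transportL2 hC hα hwi hΩ_open hΩ_bounded hT]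
    exact hb.transportL2_ae_eq hα hΩ_open hΩ_bounded h0 f₀ t
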